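/- **Setting.** Let $n\ge 1$, let $\Lambda\in\mathbb R^{n\times n}$ be diagonal and positive definite, $H\in\mathbb R^{n\times n}$, $B\in\mathbb R^{n\times m}$, $K\in\mathbb R^{m\times n}$, and let $\alpha,\mu,\nu,\beta_1,\beta_2,\beta_3,\zeta>0$ and a diagonal positive definite $D$ be given. Write $|\cdot|$ for the Euclidean norm, $\|\cdot\|_2$ for the induced matrix norm, $|x|_\infty=\max_i|x_i|$, $F=BK$, $Q=F^\top D^2F$, $G=H^\top D^2F$, $\rho=e^{-\mu}-\nu^2$. Assume the gain conditions $$\|D(H+BK)D^{-1}\|_2\le\nu<1,\qquad \Omega:=\begin{bmatrix}\rho\beta_1D^2&-\beta_1(G+Q)&0\\ *&2\alpha\beta_3I-(\beta_1+\alpha^2\beta_2)Q&\beta_3I+\alpha\beta_2G^\top\\ *&*&\beta_2(\rho D^2+Q+G+G^\top)\end{bmatrix}>\zeta I .$$ For $\varphi\in H^1((0,1);\mathbb R^n)$ and $\eta\in\mathbb R^n$ let $$V(\varphi,\eta)=\int_0^1\big(\varphi^\top P_1\varphi+\partial\varphi^\top P_2\,\partial\varphi\big)e^{-\mu z}\,dz+\beta_3|\eta-\varphi(1)|^2,\qquad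 P_1=\beta_1D^2\Lambda^{-1},\; P_2=\beta_2D^2\Lambda,\; P_3=\beta_3I .$$ For a measurement signal $y\in L^\infty_{loc}([0,\infty);\mathbb R^n)$ consider the loop $$X_t+\Lambda X_z=0,\quad X(0,t)=HX(1,t)+BK\eta(t),\quad \dot\eta=-\alpha\eta+\alpha y,\quad X(\cdot,0)=X^0,\ \eta(0)=\eta^0;$$ solutions are weak solutions $(X,\eta)\in C^0([0,\infty);H^1((0,1);\mathbb R^n)\times\mathbb R^n)$, the boundary condition holding for every $t\ge0$. Call positive constants $\underline c_P,c_D,\sigma,\chi$ *admissible* if (a) $\underline c_P\big(\|\varphi\|_{H^1}^2+|\eta-\varphi(1)|^2\big)\le V(\varphi,\eta)$ for all $\varphi\in H^1$, $\eta\in\mathbb R^n$; (b) $\max_{z\in[0,1]}|\varphi(z)|^2\le c_D\big(\|\varphi\|_{H^1}^2+|\eta-\varphi(1)|^2\big)$ for all $\varphi\in H^1$, $\eta\in\mathbb R^n$ with $\varphi(0)=H\varphi(1)+BK\eta$; (c) $\dot V(X(t),\eta(t))\le-\sigma V(X(t),\eta(t))+\chi|d(t)|^2$, in integrated form over every interval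 $[s,t]\subset[0,\infty)$, along every solution of the loop with $y(t)=X(1,t)+d(t)$ and $d\in L^\infty_{loc}$. A quantizer of range $M_q>0$ and sensitivity $\Delta_q>0$ is a map $q:\mathbb R^n\to\mathbb R^n$ with finitely many values such that $|q(x)-x|_\infty\le\Delta_q$ if $|x|_\infty\le M_q$, and $|q(x)|_\infty\ge M_q-\Delta_q$ if $|x|_\infty>M_q$. **Theorem.** Admissible constants exist; the following are admissible: $$\underline c_P=e^{-\mu}\min_{i=1,2,3}\lambda_{\min}(P_i),\quad c_D=\frac{\max\{\|D\|_2^2,\|DF\|_2^2\}}{\lambda_{\min}(D)^2(1-\nu)^2},\quad \sigma=\min\Big\{\mu\lambda_{\min}(\Lambda),\frac{\zeta}{2\beta_3}\Big\},$$ $$\chi=\frac{4\alpha^4\beta_2^2\|Q\|_2^2}{\zeta}+\frac{\alpha^2\beta_2^2\|G\|_2^2}{\zeta}+\alpha^2\beta_2\|Q\|_2+\frac{4\alpha^2\beta_3^2}{\zeta}.$$ Moreover, for all admissible constants $\underline c_P,c_D,\sigma,\chi$, every quantizer $q$ of range $M_q$ and sensitivity $\Delta_q$ with $$\frac{M_q^2}{\Delta_q^2}>\frac{n\,c_D\,\chi}{\underline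 c_P\,\sigma},$$ and every solution $(X,\eta)$ of the loop with the quantized measurement $y(t)=q(X(1,t))$ and initial data satisfying $V(X^0,\eta^0)\le\frac{\underline c_P}{c_D}M_q^2$: 1. $|X(1,t)|_\infty\le M_q$ for all $t\ge0$; 2. for every $\varepsilon>0$ there is $T\ge0$ such that $\max_{z\in[0,1]}|X(z,t)|^2\le\frac{n\chi c_D}{\sigma\underline c_P}\,\Delta_q^2\,(1+\varepsilon)$ for all $t\ge T$. -/

import Mathlib

open Set Filter Topology MeasureTheory
open scoped Matrix ContDiff

noncomputable section

namespace HypQuant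

/-- Euclidean space `ℝⁿ`. -/
abbrev E (n : ℕ) := EuclideanSpace ℝ (Fin n)

/-- Matrix acting on a Euclidean vector. -/
def mulE {a b : ℕ} (A : Matrix (Fin a) (Fin b) ℝ) (x : E b) : E a :=
  WithLp.toLp 2 (A *ᵥ (fun i => x i))

/-- Induced Euclidean (spectral) norm of a square matrix. -/
def norm2 {n : ℕ} (A : Matrix (Fin n) (Fin n) ℝ) : ℝ :=
  ‖Matrix.toEuclideanCLM (n := Fin n) (𝕜 := ℝ) A‖

/-- The maximum norm `|x|_∞ = max_i |x_i|`. -/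
def supNorm {n : ℕ} (x : E n) : ℝ := ‖(fun i => x i : Fin n → ℝ)‖

/-- Raw data (no properties): the plant `Λ = diag lam`, `H`, `B`; the controller `K`, `α`;
the parameters `D = diag dd`, `μ`, `ν`, `β₁`, `β₂`, `β₃`, `ζ` of the gain conditions. -/
structure LoopData (n m : ℕ) where
  lam : Fin n → ℝ
  H : Matrix (Fin n) (Fin n) ℝ
  B : Matrix (Fin n) (Fin m) ℝ
  K : Matrix (Fin m) (Fin n) ℝ
  α : ℝ
  dd : Fin n → ℝ
  μ : ℝ
  ν : ℝ
  β₁ : ℝ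
  β₂ : ℝ
  β₃ : ℝ
  ζ : ℝ

/-! ### The space `H¹((0,1); ℝⁿ)` and the closed loop -/

/-- `φ` restricted to `[0,1]` is (the continuous representative of) an `H¹((0,1); ℝⁿ)` function:
it is the integral of its a.e. derivative, which is square integrable. -/
def IsH1 {n : ℕ} (φ : ℝ → E n) : Prop :=
  MemLp (deriv φ) 2 (volume.restrict (Ioo (0 : ℝ) 1)) ∧
    ∀ z ∈ Icc (0 : ℝ) 1, φ z = φ 0 + ∫ s in (0 : ℝ)..z, deriv φ s

/-- Squared `H¹((0,1); ℝⁿ)` norm. -/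
def h1NormSq {n : ℕ} (φ : ℝ → E n) : ℝ :=
  (∫ z in (0 : ℝ)..1, ‖φ z‖ ^ 2) + ∫ z in (0 : ℝ)..1, ‖deriv φ z‖ ^ 2

namespace LoopData

variable {n m : ℕ}

/-- `F = B K`. -/
def F (P : LoopData n m) : Matrix (Fin n) (Fin n) ℝ := P.B * P.K

/-- `D = diag dd`. -/
def D (P : LoopData n m) : Matrix (Fin n) (Fin n) ℝ := Matrix.diagonal P.dd

/-- `Q = Fᵀ D² F`. -/
def Q (P : LoopData n m) : Matrix (Fin n) (Fin n) ℝ := P.Fᵀ * (P.D * P.D) * P.F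

/-- `G = Hᵀ D² F`. -/
def G (P : LoopData n m) : Matrix (Fin n) (Fin n) ℝ := P.Hᵀ * (P.D * P.D) * P.F

/-- `ρ = exp (-μ) - ν²`. -/
def rho (P : LoopData n m) : ℝ := Real.exp (-P.μ) - P.ν ^ 2

/-- Compatibility condition `φ(0) = H φ(1) + B K η`. -/
def Compat (P : LoopData n m) (φ : ℝ → E n) (η : E n) : Prop :=
  φ 0 = mulE P.H (φ 1) + mulE (P.B * P.K) η

/-- `(X, η)`, with `X t z` the value of the state at time `t ≥ 0` and position `z ∈ [0,1]`, is a
weak solution in `C⁰([0,∞); H¹((0,1); ℝⁿ) × ℝⁿ)` of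
`X_t + Λ X_z = 0`, `X(0,t) = H X(1,t) + B K η(t)`, `η' = -α η + α y(t)`,
with initial condition `(Xi, ηi)`, for the measurement signal `y ∈ L^∞_loc` fed to the
controller. -/
structure IsSolution (P : LoopData n m) (Xi : ℝ → E n) (ηi : E n) (y : ℝ → E n)
    (X : ℝ → ℝ → E n) (η : ℝ → E n) : Prop where
  meas : ∀ T : ℝ, 0 ≤ T → MemLp y ⊤ (volume.restrict (Icc (0 : ℝ) T))
  h1 : ∀ t : ℝ, 0 ≤ t → IsH1 (X t)
  cont_h1 : ∀ t : ℝ, 0 ≤ t →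
    Tendsto (fun s => h1NormSq (fun z => X s z - X t z)) (𝓝[Ici 0] t) (𝓝 0)
  cont_eta : ContinuousOn η (Ici 0)
  init_X : ∀ z ∈ Icc (0 : ℝ) 1, X 0 z = Xi z
  init_eta : η 0 = ηi
  pde : ∀ (i : Fin n) (ψ : ℝ → ℝ), ContDiff ℝ ∞ ψ → HasCompactSupport ψ →
    tsupport ψ ⊆ Ioo (0 : ℝ) 1 → ∀ t : ℝ, 0 ≤ t →
      ∫ z in (0 : ℝ)..1, X t z i * ψ z =
        (∫ z in (0 : ℝ)..1, X 0 z i * ψ z) +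
          P.lam i * ∫ s in (0 : ℝ)..t, ∫ z in (0 : ℝ)..1, X s z i * deriv ψ z
  bdry : ∀ t : ℝ, 0 ≤ t → P.Compat (X t) (η t)
  ode : ∀ t : ℝ, 0 ≤ t → η t = ηi + ∫ s in (0 : ℝ)..t, (-(P.α • η s) + P.α • y s)

/-! ### Gain conditions -/

/-- The symmetric `3n × 3n` matrix `Ω`. -/
def Omega (P : LoopData n m) :
    Matrix (Fin n ⊕ (Fin n ⊕ Fin n)) (Fin n ⊕ (Fin n ⊕ Fin n)) ℝ :=
  let O12 : Matrix (Fin n) (Fin n) ℝ := -(P.β₁ • (P.G + P.Q))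
  let O22 : Matrix (Fin n) (Fin n) ℝ :=
    (2 * P.α * P.β₃) • (1 : Matrix (Fin n) (Fin n) ℝ) - (P.β₁ + P.α ^ 2 * P.β₂) • P.Q
  let O23 : Matrix (Fin n) (Fin n) ℝ :=
    P.β₃ • (1 : Matrix (Fin n) (Fin n) ℝ) + (P.α * P.β₂) • P.Gᵀ
  let O33 : Matrix (Fin n) (Fin n) ℝ :=
    P.β₂ • (P.rho • (P.D * P.D) + P.Q + P.G + P.Gᵀ)
  Matrix.fromBlocks ((P.rho * P.β₁) • (P.D * P.D)) (Matrix.fromCols O12 0)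
    (Matrix.fromRows O12ᵀ 0) (Matrix.fromBlocks O22 O23 O23ᵀ O33)

/-- Sign conditions on the data, `‖D (H + B K) D⁻¹‖₂ ≤ ν < 1`, and `Ω > ζ I`. -/
structure GainCond (P : LoopData n m) : Prop where
  lam_pos : ∀ i, 0 < P.lam i
  dd_pos : ∀ i, 0 < P.dd i
  α_pos : 0 < P.α
  μ_pos : 0 < P.μ
  ν_pos : 0 < P.ν
  β₁_pos : 0 < P.β₁
  β₂_pos : 0 < P.β₂
  β₃_pos : 0 < P.β₃
  ζ_pos : 0 < P.ζ
  damping : norm2 (P.D * (P.H + P.B * P.K) * P.D⁻¹) ≤ P.ν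
  ν_lt_one : P.ν < 1
  omega_gt : (P.Omega - P.ζ • 1).PosDef

/-! ### Lyapunov function and constants -/

/-- Diagonal of `P₁ = β₁ D² Λ⁻¹`. -/
def p1 (P : LoopData n m) (i : Fin n) : ℝ := P.β₁ * P.dd i ^ 2 / P.lam i

/-- Diagonal of `P₂ = β₂ (D Λ)² Λ⁻¹ = β₂ D² Λ`. -/
def p2 (P : LoopData n m) (i : Fin n) : ℝ := P.β₂ * P.dd i ^ 2 * P.lam i

/-- The Lyapunov function
`V(φ,η) = ∫₀¹ φᵀ P₁ φ e^{-μz} dz + ∫₀¹ ∂φᵀ P₂ ∂φ e^{-μz} dz + (η - φ(1))ᵀ P₃ (η - φ(1))`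
with `P₃ = β₃ I`. -/
def V (P : LoopData n m) (φ : ℝ → E n) (η : E n) : ℝ :=
  (∫ z in (0 : ℝ)..1, (∑ i, P.p1 i * φ z i ^ 2) * Real.exp (-P.μ * z)) +
  (∫ z in (0 : ℝ)..1, (∑ i, P.p2 i * deriv φ z i ^ 2) * Real.exp (-P.μ * z)) +
  P.β₃ * ‖η - φ 1‖ ^ 2

/-- Dissipation inequality `V' ≤ -σ V + χ |d|²`, in integrated form, along all solutions
of the closed loop with measurement `y(t) = X(1,t) + d(t)` for all disturbances `d ∈ L^∞_loc`. -/
def Dissipation (P : LoopData n m) (σ χ : ℝ) : Prop :=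
  ∀ (Xi : ℝ → E n) (ηi : E n) (d : ℝ → E n) (X : ℝ → ℝ → E n) (η : ℝ → E n),
    (∀ T : ℝ, 0 ≤ T → MemLp d ⊤ (volume.restrict (Icc (0 : ℝ) T))) →
    P.IsSolution Xi ηi (fun t => X t 1 + d t) X η →
    ∀ s t : ℝ, 0 ≤ s → s ≤ t →
      P.V (X t) (η t) ≤ P.V (X s) (η s) +
        ∫ r in s..t, (-σ * P.V (X r) (η r) + χ * ‖d r‖ ^ 2)

/-- The positive constants `c_P`, `c_D`, `σ`, `χ` satisfy the inequalities that they stand for. -/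
structure Admissible (P : LoopData n m) (cP cD σ χ : ℝ) : Prop where
  cP_pos : 0 < cP
  cD_pos : 0 < cD
  σ_pos : 0 < σ
  χ_pos : 0 < χ
  coercive : ∀ (φ : ℝ → E n) (η : E n), IsH1 φ →
    cP * (h1NormSq φ + ‖η - φ 1‖ ^ 2) ≤ P.V φ η
  max_bound : ∀ (φ : ℝ → E n) (η : E n), IsH1 φ → P.Compat φ η →
    ∀ z ∈ Icc (0 : ℝ) 1, ‖φ z‖ ^ 2 ≤ cD * (h1NormSq φ + ‖η - φ 1‖ ^ 2)
  dissip : P.Dissipation σ χ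

/-- `c_P = e^{-μ} min_i λ_min(P_i)`. -/
def cP (P : LoopData n m) : ℝ :=
  Real.exp (-P.μ) * min (⨅ i, P.p1 i) (min (⨅ i, P.p2 i) P.β₃)

/-- `c_D = max {‖D‖₂², ‖D F‖₂²} / (λ_min(D)² (1 - ν)²)`. -/
def cD (P : LoopData n m) : ℝ :=
  max (norm2 P.D ^ 2) (norm2 (P.D * P.F) ^ 2) / ((⨅ i, P.dd i) ^ 2 * (1 - P.ν) ^ 2)

/-- `σ = min {μ λ_min(Λ), ζ / (2 β₃)}`. -/
def sigma (P : LoopData n m) : ℝ := min (P.μ * ⨅ i, P.lam i) (P.ζ / (2 * P.β₃))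

/-- `χ = 4 α⁴ β₂² ‖Q‖₂² / ζ + α² β₂² ‖G‖₂² / ζ + α² β₂ ‖Q‖₂ + 4 α² β₃² / ζ`. -/
def chi (P : LoopData n m) : ℝ :=
  4 * P.α ^ 4 * P.β₂ ^ 2 * norm2 P.Q ^ 2 / P.ζ + P.α ^ 2 * P.β₂ ^ 2 * norm2 P.G ^ 2 / P.ζ +
    P.α ^ 2 * P.β₂ * norm2 P.Q + 4 * P.α ^ 2 * P.β₃ ^ 2 / P.ζ

end LoopData

/-! ### Quantizer -/

/-- `q` is a quantizer with range `M` and sensitivity `Δ`: it takes finitely many values, its error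
is at most `Δ` on the range, and overflow is detected. -/
structure IsQuantizer {n : ℕ} (q : E n → E n) (M Δ : ℝ) : Prop where
  M_pos : 0 < M
  Δ_pos : 0 < Δ
  finite : (Set.range q).Finite
  error_le : ∀ x, supNorm x ≤ M → supNorm (q x - x) ≤ Δ
  overflow : ∀ x, M < supNorm x → M - Δ ≤ supNorm (q x)

end HypQuant

end

/-! ### Absolutely continuous functions and almost everywhere derivatives. -/

namespace HypQuant

/-! Two separate facts are proved: the explicit constants are admissible, and any admissible
constants yield invariance and the ultimate bound.

Admissibility. Coercivity is a termwise comparison of weights. The maximum bound (`max_bound`) holds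
because the boundary condition contracts the `D`-weighted norm by `ν` up to an error in `η - φ(1)`,
while the squared norm varies along `[0,1]` by at most the squared `H¹` norm. For the dissipation
inequality, `X` is too irregular to differentiate `V` under the integral. Instead, the weak equation
makes each component constant along its characteristics (`eq_along_characteristic`), so it is a
delayed copy of its boundary trace at `z = 0` (`inflow_eq`). Then `V` becomes a sum of exponentially
weighted integrals over moving time windows plus a boundary term (`V_eq`). Such integrals are
absolutely continuous with an explicit a.e. derivative (`movingWindow_absolutelyContinuous`):
interior decay plus the values at the two ends of the window. The end values are controlled by `Ω >
ζ I` and Young's inequality (`boundary_dissipation`).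

Quantized loop. Where `V ≤ (cP/cD) M²`, conditions (a) and (b) give only `|X(1,t)| ≤ M`. That is not
enough at the edge of the level set: the state could leave the quantizer range at once, and the
error bound would be lost before `V` is shown to decrease. The inequality is in fact strict
(`norm_sq_lt`). If (a) and (b) were both equalities at some `φ` with `φ(1) ≠ 0`, stationarity would
force a component with `φᵢ(1) ≠ 0` to be a multiple of `exp(kz)`, where `k = (p₂ - p₁)/(μ p₂)`. The
Euler equation of the unweighted `H¹` norm gives `k² = 1`, whereas variations free at the endpoints
give `p₁ = p₂`, that is `k = 0`.

With strictness, continuity keeps `|X(1,·)| < M` for a short time, so the error is at most `√n Δ`,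
`V` cannot rise above the level, and the level set is invariant (`level_invariant`). The error bound
then holds for all time, and dissipation drives `V` below every level above `n χ Δ²/σ`
(`eventually_V_le`). -/

theorem _root_.AbsolutelyContinuousOnInterval.congr {f g : ℝ → ℝ} {a b : ℝ}
    (hf : AbsolutelyContinuousOnInterval f a b) (hfg : ∀ x ∈ uIcc a b, g x = f x) :
    AbsolutelyContinuousOnInterval g a b := by
  rw [absolutelyContinuousOnInterval_iff] at hf ⊢
  intro ε hε
  obtain ⟨δ, hδ, h⟩ := hf ε hε
  refine ⟨δ, hδ, fun E hE hl => ?_⟩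
  refine lt_of_eq_of_lt (Finset.sum_congr rfl fun i hi => ?_) (h E hE hl)
  rw [hfg _ (hE.1 i hi).1, hfg _ (hE.1 i hi).2]

theorem _root_.AbsolutelyContinuousOnInterval.sum {ι : Type*} {s : Finset ι} {f : ι → ℝ → ℝ}
    {a b : ℝ} (hf : ∀ i ∈ s, AbsolutelyContinuousOnInterval (f i) a b) :
    AbsolutelyContinuousOnInterval (fun x => ∑ i ∈ s, f i x) a b := by
  classical
  induction s using Finset.induction_on with
  | empty =>
    simp only [Finset.sum_empty]
    exact (contDiffOn_const (c := (0 : ℝ))).absolutelyContinuousOnInterval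
  | insert i s hi ih =>
    simp only [Finset.sum_insert hi]
    exact (hf i (Finset.mem_insert_self i s)).add
      (ih fun j hj => hf j (Finset.mem_insert_of_mem hj))

/-- A real function that is the integral of an integrable function is absolutely continuous. -/
theorem absolutelyContinuousOnInterval_of_integral {f g : ℝ → ℝ} {a b c : ℝ}
    (hg : IntervalIntegrable g volume a b) (h : ∀ x ∈ uIcc a b, f x = c + ∫ s in a..x, g s) :
    AbsolutelyContinuousOnInterval f a b :=
  ((contDiffOn_const (c := c)).absolutelyContinuousOnInterval.add
    (hg.absolutelyContinuousOnInterval_intervalIntegral left_mem_uIcc)).congr h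

section Vector

variable {G : Type*} [NormedAddCommGroup G] [NormedSpace ℝ G] [CompleteSpace G]

/-- The integral of an integrable function is differentiable almost everywhere. -/
theorem ae_hasDerivAt_of_integral {f g : ℝ → G} {a b : ℝ} {c : G} (hab : a ≤ b)
    (hg : IntervalIntegrable g volume a b) (h : ∀ x ∈ Icc a b, f x = c + ∫ s in a..x, g s) :
    ∀ᵐ x, x ∈ Ioo a b → HasDerivAt f (g x) x := by
  filter_upwards [hg.ae_hasDerivAt_integral] with x hx hxab
  rw [uIcc_of_le hab] at hx
  refine ((hx (Ioo_subset_Icc_self hxab) a (left_mem_Icc.2 hab)).const_add c).congr_of_eventuallyEq ?_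
  filter_upwards [Icc_mem_nhds hxab.1 hxab.2] with y hy using h y hy

end Vector

theorem ae_restrict_Ioo_of_ae {p : ℝ → Prop} {a b : ℝ} (h : ∀ᵐ x, x ∈ Ioo a b → p x) :
    ∀ᵐ x ∂(volume.restrict (Ioo a b)), p x :=
  (ae_restrict_iff' measurableSet_Ioo).2 h

theorem ae_uIoc_of_ae_Ioo {p : ℝ → Prop} {a b : ℝ} (hab : a ≤ b)
    (h : ∀ᵐ x, x ∈ Ioo a b → p x) : ∀ᵐ x, x ∈ uIoc a b → p x := by
  have hb : ∀ᵐ x : ℝ, x ≠ b := by simp [ae_iff, measure_singleton]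
  filter_upwards [h, hb] with x hx hxb hxm
  rw [uIoc_of_le hab] at hxm
  exact hx ⟨hxm.1, lt_of_le_of_ne hxm.2 hxb⟩

/-! ### The space `H¹`: components, linear images and bounds on point values. -/

namespace IsH1

variable {n : ℕ} {φ ψ : ℝ → E n}

theorem intervalIntegrable (h : IsH1 φ) : IntervalIntegrable (deriv φ) volume 0 1 := by
  rw [intervalIntegrable_iff_integrableOn_Ioo_of_le zero_le_one]
  exact h.1.integrable (by norm_num)

theorem intervalIntegrable_sq (h : IsH1 φ) :
    IntervalIntegrable (fun z => ‖deriv φ z‖ ^ 2) volume 0 1 := by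
  rw [intervalIntegrable_iff_integrableOn_Ioo_of_le zero_le_one]
  exact h.1.integrable_norm_pow (by norm_num)

theorem ae_hasDerivAt (h : IsH1 φ) : ∀ᵐ z, z ∈ Ioo (0 : ℝ) 1 → HasDerivAt φ (deriv φ z) z :=
  ae_hasDerivAt_of_integral zero_le_one h.intervalIntegrable h.2

theorem continuousOn (h : IsH1 φ) : ContinuousOn φ (Icc 0 1) := by
  have := intervalIntegral.continuousOn_primitive_interval' h.intervalIntegrable
    (left_mem_uIcc (a := (0 : ℝ)) (b := 1))
  rw [uIcc_of_le zero_le_one] at this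
  exact (continuousOn_const.add this).congr h.2

theorem apply_eq (h : IsH1 φ) (i : Fin n) {z : ℝ} (hz : z ∈ Icc (0 : ℝ) 1) :
    φ z i = φ 0 i + ∫ s in (0 : ℝ)..z, deriv φ s i := by
  have hi : IntervalIntegrable (deriv φ) volume 0 z :=
    h.intervalIntegrable.mono_set (uIcc_subset_uIcc_left (by rwa [uIcc_of_le zero_le_one]))
  have := ContinuousLinearMap.intervalIntegral_comp_comm
    (EuclideanSpace.proj i : E n →L[ℝ] ℝ) hi
  simp only [EuclideanSpace.coe_proj] at this
  rw [this]
  conv_lhs => rw [h.2 z hz]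
  simp

theorem intervalIntegrable_apply (h : IsH1 φ) (i : Fin n) :
    IntervalIntegrable (fun z => deriv φ z i) volume 0 1 := by
  have := h.intervalIntegrable
  rw [intervalIntegrable_iff] at this ⊢
  exact (EuclideanSpace.proj i : E n →L[ℝ] ℝ).integrable_comp this

theorem intervalIntegrable_apply_sq (h : IsH1 φ) (i : Fin n) :
    IntervalIntegrable (fun z => deriv φ z i ^ 2) volume 0 1 := by
  refine h.intervalIntegrable_sq.mono_fun ?_ ?_
  · have := (h.intervalIntegrable_apply i)
    rw [intervalIntegrable_iff] at this
    exact this.aestronglyMeasurable.pow 2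
  · refine ae_of_all _ fun z => ?_
    simp only [norm_pow, norm_norm]
    gcongr
    exact PiLp.norm_apply_le _ i

theorem absolutelyContinuous (h : IsH1 φ) (i : Fin n) :
    AbsolutelyContinuousOnInterval (fun z => φ z i) 0 1 :=
  absolutelyContinuousOnInterval_of_integral (c := φ 0 i) (h.intervalIntegrable_apply i)
    fun z hz => h.apply_eq i (by rwa [uIcc_of_le zero_le_one] at hz)

theorem ae_hasDerivAt_apply (h : IsH1 φ) (i : Fin n) :
    ∀ᵐ z, z ∈ Ioo (0 : ℝ) 1 → HasDerivAt (fun z => φ z i) (deriv φ z i) z :=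
  ae_hasDerivAt_of_integral zero_le_one (h.intervalIntegrable_apply i) fun _ hz => h.apply_eq i hz

/-- A function that is a.e. differentiable with the right integral is `H¹`. -/
theorem of_hasDerivAt {g : ℝ → E n} (hg : MemLp g 2 (volume.restrict (Ioo (0 : ℝ) 1)))
    (h : ∀ z ∈ Icc (0 : ℝ) 1, φ z = φ 0 + ∫ s in (0 : ℝ)..z, g s) : IsH1 φ := by
  have hgi : IntervalIntegrable g volume 0 1 := by
    rw [intervalIntegrable_iff_integrableOn_Ioo_of_le zero_le_one]
    exact hg.integrable (by norm_num)
  have hae : ∀ᵐ z, z ∈ Ioo (0 : ℝ) 1 → deriv φ z = g z := by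
    filter_upwards [ae_hasDerivAt_of_integral zero_le_one hgi h] with z hz hz1
    exact (hz hz1).deriv
  refine ⟨hg.ae_eq (ae_restrict_Ioo_of_ae (by
    filter_upwards [hae] with z hz hz1 using (hz hz1).symm)), fun z hz => ?_⟩
  rw [h z hz]
  congr 1
  refine intervalIntegral.integral_congr_ae (ae_uIoc_of_ae_Ioo hz.1 ?_)
  filter_upwards [hae] with s hs hs1
  exact (hs ⟨hs1.1, hs1.2.trans_le hz.2⟩).symm

theorem add_smul (hφ : IsH1 φ) (hψ : IsH1 ψ) (c : ℝ) : IsH1 (fun z => φ z + c • ψ z) := by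
  refine of_hasDerivAt (g := fun z => deriv φ z + c • deriv ψ z) (hφ.1.add (hψ.1.const_smul c))
    fun z hz => ?_
  have hz' : uIcc (0 : ℝ) z ⊆ uIcc 0 1 := uIcc_subset_uIcc_left (by rwa [uIcc_of_le zero_le_one])
  have hs : IntervalIntegrable (fun z => c • deriv ψ z) volume 0 z :=
    (hψ.intervalIntegrable.mono_set hz').smul c
  rw [intervalIntegral.integral_add (hφ.intervalIntegrable.mono_set hz') hs,
    intervalIntegral.integral_smul]
  rw [hφ.2 z hz, hψ.2 z hz, smul_add]
  abel

theorem sub (hφ : IsH1 φ) (hψ : IsH1 ψ) : IsH1 (fun z => φ z - ψ z) := by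
  simpa [sub_eq_add_neg] using hφ.add_smul hψ (-1)

theorem clm (hφ : IsH1 φ) (L : E n →L[ℝ] E n) : IsH1 (fun z => L (φ z)) := by
  refine of_hasDerivAt (g := fun z => L (deriv φ z)) (L.comp_memLp' hφ.1) fun z hz => ?_
  have hz' : uIcc (0 : ℝ) z ⊆ uIcc 0 1 := uIcc_subset_uIcc_left (by rwa [uIcc_of_le zero_le_one])
  rw [L.intervalIntegral_comp_comm (hφ.intervalIntegrable.mono_set hz'), ← map_add, ← hφ.2 z hz]

theorem of_contDiff (h : ContDiff ℝ 1 φ) : IsH1 φ := by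
  have hc : Continuous (deriv φ) := h.continuous_deriv (by norm_num)
  refine ⟨?_, fun z _ => ?_⟩
  · obtain ⟨C, hC⟩ := isCompact_Icc.exists_bound_of_continuousOn (hc.continuousOn (s := Icc (0 : ℝ) 1))
    exact MemLp.of_bound hc.aestronglyMeasurable C ((ae_restrict_iff' measurableSet_Ioo).2
      (ae_of_all _ fun x hx => hC x (Ioo_subset_Icc_self hx)))
  · rw [intervalIntegral.integral_deriv_eq_sub (fun x _ => h.differentiable (by norm_num) x)
      (hc.intervalIntegrable _ _)]
    abel

theorem intervalIntegrable_norm_sq (h : IsH1 φ) :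
    IntervalIntegrable (fun z => ‖φ z‖ ^ 2) volume 0 1 := by
  refine ContinuousOn.intervalIntegrable ?_
  rw [uIcc_of_le zero_le_one]
  exact h.continuousOn.norm.pow 2

/-- The derivative of `|φ|²` is `2 φ·φ'`, at most `|φ|² + |φ'|²` in absolute value, whose integral
over `[0,1]` is the squared `H¹` norm. The coefficient 1 here is what gives `cD` its stated value.
-/
theorem norm_sq_le_add (h : IsH1 φ) {y z : ℝ} (hy : y ∈ Icc (0 : ℝ) 1) (hz : z ∈ Icc (0 : ℝ) 1) :
    ‖φ z‖ ^ 2 ≤ ‖φ y‖ ^ 2 + h1NormSq φ := by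
  have hsub : uIcc y z ⊆ uIcc 0 1 := by
    rw [uIcc_of_le zero_le_one]; exact ordConnected_Icc.uIcc_subset hy hz
  have hac : AbsolutelyContinuousOnInterval (fun z => ∑ i, φ z i * φ z i) 0 1 :=
    AbsolutelyContinuousOnInterval.sum fun i _ =>
      (h.absolutelyContinuous i).mul (h.absolutelyContinuous i)
  have heq := (hac.mono hsub).integral_deriv_eq_sub
  have hn : ∀ x, ∑ i, φ x i * φ x i = ‖φ x‖ ^ 2 := fun x => by
    rw [EuclideanSpace.real_norm_sq_eq]; simp [sq]
  have hd : ∀ᵐ x, x ∈ Ioo (0 : ℝ) 1 →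
      |deriv (fun z => ∑ i, φ z i * φ z i) x| ≤ ‖φ x‖ ^ 2 + ‖deriv φ x‖ ^ 2 := by
    filter_upwards [ae_all_iff.2 h.ae_hasDerivAt_apply] with x hx hx1
    have : HasDerivAt (fun z => ∑ i, φ z i * φ z i)
        (∑ i, (deriv φ x i * φ x i + φ x i * deriv φ x i)) x := by
      exact HasDerivAt.fun_sum (u := Finset.univ) fun i _ => (hx i hx1).fun_mul (hx i hx1)
    rw [this.deriv, EuclideanSpace.real_norm_sq_eq, EuclideanSpace.real_norm_sq_eq,
      ← Finset.sum_add_distrib]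
    refine (Finset.abs_sum_le_sum_abs _ _).trans (Finset.sum_le_sum fun i _ => ?_)
    rw [abs_le]
    constructor <;> nlinarith [sq_nonneg (φ x i + deriv φ x i), sq_nonneg (φ x i - deriv φ x i)]
  have hint : IntervalIntegrable (fun x => ‖φ x‖ ^ 2 + ‖deriv φ x‖ ^ 2) volume 0 1 :=
    h.intervalIntegrable_norm_sq.add h.intervalIntegrable_sq
  have hI : h1NormSq φ = ∫ x in (0 : ℝ)..1, (‖φ x‖ ^ 2 + ‖deriv φ x‖ ^ 2) := by
    rw [intervalIntegral.integral_add h.intervalIntegrable_norm_sq h.intervalIntegrable_sq]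
    rfl
  have hb : |∫ x in y..z, deriv (fun z => ∑ i, φ z i * φ z i) x| ≤ h1NormSq φ := by
    rw [hI, intervalIntegral.integral_of_le zero_le_one]
    rw [← Real.norm_eq_abs]
    refine intervalIntegral.norm_integral_le_integral_norm_uIoc.trans ?_
    have hs : uIoc y z ⊆ Ioc 0 1 := by
      exact Ioc_subset_Ioc (le_min hy.1 hz.1) (max_le hy.2 hz.2)
    have h1 := hac.intervalIntegrable_deriv.norm
    rw [intervalIntegrable_iff, uIoc_of_le zero_le_one] at h1 hint
    refine (setIntegral_mono_set h1 (ae_of_all _ fun _ => norm_nonneg _) hs.eventuallyLE).trans ?_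
    refine setIntegral_mono_ae_restrict h1 hint ?_
    refine (ae_restrict_iff' measurableSet_Ioc).2 ?_
    have := ae_uIoc_of_ae_Ioo zero_le_one hd
    rwa [uIoc_of_le zero_le_one] at this
  rw [heq, hn, hn] at hb
  linarith [(abs_le.1 hb).2]

theorem h1NormSq_nonneg (φ : ℝ → E n) : 0 ≤ h1NormSq φ :=
  add_nonneg (intervalIntegral.integral_nonneg zero_le_one fun _ _ => by positivity)
    (intervalIntegral.integral_nonneg zero_le_one fun _ _ => by positivity)

/-- Average `norm_sq_le_add` over `y`. This turns convergence in `H¹` into uniform convergence. -/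
theorem norm_sq_le (h : IsH1 φ) {z : ℝ} (hz : z ∈ Icc (0 : ℝ) 1) :
    ‖φ z‖ ^ 2 ≤ 2 * h1NormSq φ := by
  have h1 : ∫ y in (0 : ℝ)..1, ‖φ z‖ ^ 2 ≤ ∫ y in (0 : ℝ)..1, (‖φ y‖ ^ 2 + h1NormSq φ) := by
    refine intervalIntegral.integral_mono_on zero_le_one (by simp)
      (h.intervalIntegrable_norm_sq.add (by simp)) fun y hy => h.norm_sq_le_add hy hz
  rw [intervalIntegral.integral_add h.intervalIntegrable_norm_sq (by simp)] at h1
  have h2 : ∫ z in (0 : ℝ)..1, ‖φ z‖ ^ 2 ≤ h1NormSq φ :=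
    le_add_of_nonneg_right
      (intervalIntegral.integral_nonneg zero_le_one fun _ _ => by positivity)
  simp at h1
  linarith

end IsH1

/-! ### Matrices acting on Euclidean vectors. -/

section MulE

variable {a b c : ℕ}

theorem mulE_apply (A : Matrix (Fin a) (Fin b) ℝ) (x : E b) (i : Fin a) :
    mulE A x i = ∑ j, A i j * x j := rfl

theorem mulE_add (A : Matrix (Fin a) (Fin b) ℝ) (x y : E b) :
    mulE A (x + y) = mulE A x + mulE A y := by
  ext i; simp [mulE_apply, mul_add, Finset.sum_add_distrib]

theorem mulE_smul (A : Matrix (Fin a) (Fin b) ℝ) (r : ℝ) (x : E b) :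
    mulE A (r • x) = r • mulE A x := by
  ext i; simp [mulE_apply, Finset.mul_sum, mul_left_comm]

theorem add_mulE (A B : Matrix (Fin a) (Fin b) ℝ) (x : E b) :
    mulE (A + B) x = mulE A x + mulE B x := by
  ext i; simp [mulE_apply, add_mul, Finset.sum_add_distrib]

theorem mulE_mulE (A : Matrix (Fin a) (Fin b) ℝ) (B : Matrix (Fin b) (Fin c) ℝ) (x : E c) :
    mulE A (mulE B x) = mulE (A * B) x := by
  unfold mulE
  rw [← Matrix.mulVec_mulVec]

theorem mulE_diagonal_apply (d : Fin a → ℝ) (x : E a) (i : Fin a) :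
    mulE (Matrix.diagonal d) x i = d i * x i := by
  simp [mulE, Matrix.mulVec_diagonal]

theorem mulE_eq_toEuclideanCLM (A : Matrix (Fin a) (Fin a) ℝ) (x : E a) :
    mulE A x = Matrix.toEuclideanCLM (n := Fin a) (𝕜 := ℝ) A x := by
  ext i
  simp [mulE]

theorem norm_mulE_le (A : Matrix (Fin a) (Fin a) ℝ) (x : E a) : ‖mulE A x‖ ≤ norm2 A * ‖x‖ := by
  rw [mulE_eq_toEuclideanCLM]
  exact ContinuousLinearMap.le_opNorm _ _

theorem norm2_nonneg (A : Matrix (Fin a) (Fin a) ℝ) : 0 ≤ norm2 A := norm_nonneg _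

end MulE

/-- The scalar inequality behind the maximum bound. -/
theorem sq_le_of_contraction {M b A S ν : ℝ} (hM : 0 ≤ M) (hν : 0 ≤ ν)
    (hν1 : ν < 1) (hb0 : 0 ≤ b) (hS : 0 ≤ S) (hb : b ≤ ν * M + A) (h : M ^ 2 ≤ b ^ 2 + S) :
    (1 - ν) ^ 2 * M ^ 2 ≤ A ^ 2 + S := by
  -- With `R² = A² + S` and `A ≤ R`, one has `(νM + A)² + S ≤ (νM + R)²`, so `M ≤ νM + R`.
  have hR : Real.sqrt (A ^ 2 + S) ^ 2 = A ^ 2 + S := Real.sq_sqrt (by positivity)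
  have hR0 := Real.sqrt_nonneg (A ^ 2 + S)
  set R := Real.sqrt (A ^ 2 + S)
  have hAR : A ≤ R := abs_le_of_sq_le_sq' (by nlinarith) hR0 |>.2
  have h1 : M ^ 2 ≤ (ν * M + R) ^ 2 := by
    have : b ^ 2 ≤ (ν * M + A) ^ 2 := by gcongr
    have h3 : ν * M * A ≤ ν * M * R := by gcongr
    nlinarith
  have h2 : M ≤ ν * M + R := abs_le_of_sq_le_sq' h1 (by positivity) |>.2
  have h3 : ((1 - ν) * M) ^ 2 ≤ R ^ 2 :=
    pow_le_pow_left₀ (mul_nonneg (by linarith) hM) (by linarith) 2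
  linarith [mul_pow (1 - ν) M 2]

/-! ### Positivity of the constants, coercivity of `V` and the maximum bound. -/

namespace LoopData

variable {n m : ℕ} {P : LoopData n m}

section Positivity

theorem iInf_pos_of_pos (hn : 0 < n) {f : Fin n → ℝ} (hf : ∀ i, 0 < f i) : 0 < ⨅ i, f i := by
  have : Nonempty (Fin n) := ⟨⟨0, hn⟩⟩
  obtain ⟨i, hi⟩ := exists_eq_ciInf_of_finite (f := f)
  rw [← hi]; exact hf i

theorem iInf_le_apply (f : Fin n → ℝ) (i : Fin n) : ⨅ i, f i ≤ f i :=
  ciInf_le (Set.finite_range f).bddBelow i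

theorem p1_pos (hP : P.GainCond) (i : Fin n) : 0 < P.p1 i := by
  have := hP.lam_pos i; have := hP.dd_pos i; have := hP.β₁_pos
  unfold p1; positivity

theorem p2_pos (hP : P.GainCond) (i : Fin n) : 0 < P.p2 i := by
  have := hP.lam_pos i; have := hP.dd_pos i; have := hP.β₂_pos
  unfold p2; positivity

theorem cP_pos (hn : 0 < n) (hP : P.GainCond) : 0 < P.cP :=
  mul_pos (Real.exp_pos _) (lt_min (iInf_pos_of_pos hn (p1_pos hP))
    (lt_min (iInf_pos_of_pos hn (p2_pos hP)) hP.β₃_pos))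

theorem D_ne_zero (hn : 0 < n) (hP : P.GainCond) : P.D ≠ 0 := fun h => by
  have := congrFun (congrFun h ⟨0, hn⟩) ⟨0, hn⟩
  simp [D] at this
  exact (hP.dd_pos _).ne' this

theorem norm2_pos {A : Matrix (Fin n) (Fin n) ℝ} (hA : A ≠ 0) : 0 < norm2 A := by
  unfold norm2
  rw [norm_pos_iff]
  simpa using hA

theorem cD_pos (hn : 0 < n) (hP : P.GainCond) : 0 < P.cD := by
  have h1 := norm2_pos (D_ne_zero hn hP)
  have h2 := iInf_pos_of_pos hn hP.dd_pos
  have h3 : 0 < 1 - P.ν := by linarith [hP.ν_lt_one]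
  unfold cD
  have : 0 < max (norm2 P.D ^ 2) (norm2 (P.D * P.F) ^ 2) := lt_max_of_lt_left (by positivity)
  positivity

theorem sigma_pos (hn : 0 < n) (hP : P.GainCond) : 0 < P.sigma := by
  have h1 := iInf_pos_of_pos hn hP.lam_pos
  have := hP.μ_pos; have := hP.ζ_pos; have := hP.β₃_pos
  exact lt_min (by positivity) (by positivity)

theorem chi_pos (hP : P.GainCond) : 0 < P.chi := by
  have := hP.ζ_pos; have := hP.β₃_pos; have := hP.α_pos; have := hP.β₂_pos
  have h1 := norm2_nonneg P.Q
  unfold chi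
  positivity

end Positivity

theorem intervalIntegrable_V_fst (P : LoopData n m) {φ : ℝ → E n} (h : IsH1 φ) :
    IntervalIntegrable (fun z => (∑ i, P.p1 i * φ z i ^ 2) * Real.exp (-P.μ * z)) volume 0 1 := by
  refine ContinuousOn.intervalIntegrable ?_
  rw [uIcc_of_le zero_le_one]
  have : ∀ i, ContinuousOn (fun z => φ z i) (Icc 0 1) := fun i =>
    (EuclideanSpace.proj i : E n →L[ℝ] ℝ).continuous.comp_continuousOn h.continuousOn
  fun_prop

theorem intervalIntegrable_V_snd (P : LoopData n m) {φ : ℝ → E n} (h : IsH1 φ) :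
    IntervalIntegrable (fun z => (∑ i, P.p2 i * deriv φ z i ^ 2) * Real.exp (-P.μ * z))
      volume 0 1 := by
  refine IntervalIntegrable.mul_continuousOn ?_ (by fun_prop)
  rw [show (fun z => ∑ i, P.p2 i * deriv φ z i ^ 2) = ∑ i, fun z => P.p2 i * deriv φ z i ^ 2 by
    ext z; simp]
  exact IntervalIntegrable.sum Finset.univ
    (fun i _ => (h.intervalIntegrable_apply_sq i).const_mul (P.p2 i))

theorem V_nonneg (hP : P.GainCond) (φ : ℝ → E n) (η : E n) : 0 ≤ P.V φ η := by
  have h1 := p1_pos hP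
  have h2 := p2_pos hP
  have h3 := hP.β₃_pos
  refine add_nonneg (add_nonneg (intervalIntegral.integral_nonneg zero_le_one fun _ _ => ?_)
    (intervalIntegral.integral_nonneg zero_le_one fun _ _ => ?_)) (by positivity)
  · exact mul_nonneg (Finset.sum_nonneg fun i _ => mul_nonneg (h1 i).le (sq_nonneg _))
      (Real.exp_pos _).le
  · exact mul_nonneg (Finset.sum_nonneg fun i _ => mul_nonneg (h2 i).le (sq_nonneg _))
      (Real.exp_pos _).le

theorem weighted_le {μ c z : ℝ} {p : Fin n → ℝ} (x : E n) (hμ : 0 < μ) (hc : ∀ i, c ≤ p i)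
    (hp : ∀ i, 0 < p i) (hz : z ≤ 1) :
    Real.exp (-μ) * c * ‖x‖ ^ 2 ≤ (∑ i, p i * x i ^ 2) * Real.exp (-μ * z) := by
  have he : Real.exp (-μ) ≤ Real.exp (-μ * z) := Real.exp_le_exp.2 (by nlinarith)
  rw [EuclideanSpace.real_norm_sq_eq, Finset.mul_sum, Finset.sum_mul]
  refine Finset.sum_le_sum fun i _ => ?_
  calc Real.exp (-μ) * c * x i ^ 2 = (c * x i ^ 2) * Real.exp (-μ) := by ring
    _ ≤ (p i * x i ^ 2) * Real.exp (-μ) := by gcongr; exact hc i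
    _ ≤ (p i * x i ^ 2) * Real.exp (-μ * z) := by
      have := (hp i).le
      gcongr

theorem coercive (hP : P.GainCond) (φ : ℝ → E n) (η : E n) (h : IsH1 φ) :
    P.cP * (h1NormSq φ + ‖η - φ 1‖ ^ 2) ≤ P.V φ η := by
  unfold V h1NormSq
  rw [mul_add, mul_add]
  refine add_le_add (add_le_add ?_ ?_) ?_
  · rw [← intervalIntegral.integral_const_mul]
    refine intervalIntegral.integral_mono_on zero_le_one
      (h.intervalIntegrable_norm_sq.const_mul _) (P.intervalIntegrable_V_fst h) fun z hz => ?_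
    exact weighted_le _ hP.μ_pos (fun i => (min_le_left _ _).trans (iInf_le_apply _ i))
      (p1_pos hP) hz.2
  · rw [← intervalIntegral.integral_const_mul]
    refine intervalIntegral.integral_mono_on zero_le_one
      (h.intervalIntegrable_sq.const_mul _) (P.intervalIntegrable_V_snd h) fun z hz => ?_
    exact weighted_le _ hP.μ_pos (fun i => (min_le_right _ _).trans
      ((min_le_left _ _).trans (iInf_le_apply _ i))) (p2_pos hP) hz.2
  · gcongr
    have h1 : Real.exp (-P.μ) ≤ 1 := Real.exp_le_one_iff.2 (by linarith [hP.μ_pos])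
    have h2 : min (⨅ i, P.p1 i) (min (⨅ i, P.p2 i) P.β₃) ≤ P.β₃ :=
      (min_le_right _ _).trans (min_le_right _ _)
    have := hP.β₃_pos
    calc P.cP ≤ Real.exp (-P.μ) * P.β₃ := mul_le_mul_of_nonneg_left h2 (Real.exp_pos _).le
      _ ≤ 1 * P.β₃ := by gcongr
      _ = P.β₃ := one_mul _

theorem D_inv_mul (hP : P.GainCond) : P.D⁻¹ * P.D = 1 := by
  refine Matrix.nonsing_inv_mul _ ?_
  rw [D, Matrix.det_diagonal, isUnit_iff_ne_zero]
  exact Finset.prod_ne_zero_iff.2 fun i _ => (hP.dd_pos i).ne'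

/-- The damping condition, written without `D⁻¹`. -/
theorem norm_D_mul_le (hP : P.GainCond) (x : E n) :
    ‖mulE P.D (mulE (P.H + P.F) x)‖ ≤ P.ν * ‖mulE P.D x‖ := by
  have : mulE P.D (mulE (P.H + P.F) x)
      = mulE (P.D * (P.H + P.B * P.K) * P.D⁻¹) (mulE P.D x) := by
    rw [mulE_mulE, mulE_mulE, Matrix.mul_assoc _ P.D⁻¹, D_inv_mul hP, Matrix.mul_one, F]
  rw [this]
  exact (norm_mulE_le _ _).trans (by gcongr; exact hP.damping)

theorem norm_le_norm_D (hP : P.GainCond) (x : E n) :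
    (⨅ i, P.dd i) ^ 2 * ‖x‖ ^ 2 ≤ ‖mulE P.D x‖ ^ 2 := by
  rw [EuclideanSpace.real_norm_sq_eq, EuclideanSpace.real_norm_sq_eq, Finset.mul_sum]
  refine Finset.sum_le_sum fun i _ => ?_
  rw [D, mulE_diagonal_apply, mul_pow]
  gcongr
  · exact Real.iInf_nonneg fun i => (hP.dd_pos i).le
  · exact iInf_le_apply _ i

/-- Isolates `H + F`, the matrix to which the damping condition applies, from the effect of the
error `η - φ(1)`. -/
theorem Compat.apply_zero {φ : ℝ → E n} {η : E n} (h : P.Compat φ η) :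
    φ 0 = mulE (P.H + P.F) (φ 1) + mulE P.F (η - φ 1) := by
  have h2 : mulE (P.B * P.K) η = mulE P.F (φ 1) + mulE P.F (η - φ 1) := by
    rw [← mulE_add]; simp [F]
  rw [h, h2, add_mulE, add_assoc]

theorem h1NormSq_mulE_le {φ : ℝ → E n} (h : IsH1 φ) (A : Matrix (Fin n) (Fin n) ℝ) :
    h1NormSq (fun z => mulE A (φ z)) ≤ norm2 A ^ 2 * h1NormSq φ := by
  have hL : IsH1 (fun z => mulE A (φ z)) := by
    simpa only [mulE_eq_toEuclideanCLM] using h.clm (Matrix.toEuclideanCLM (n := Fin n) (𝕜 := ℝ) A)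
  unfold h1NormSq
  rw [mul_add, ← intervalIntegral.integral_const_mul, ← intervalIntegral.integral_const_mul]
  have key : ∀ x : E n, ‖mulE A x‖ ^ 2 ≤ norm2 A ^ 2 * ‖x‖ ^ 2 := fun x => by
    rw [← mul_pow]; gcongr; exact norm_mulE_le A x
  refine add_le_add ?_ ?_
  · exact intervalIntegral.integral_mono_on zero_le_one hL.intervalIntegrable_norm_sq
      (h.intervalIntegrable_norm_sq.const_mul _) fun z _ => key _
  · refine intervalIntegral.integral_mono_ae_restrict zero_le_one hL.intervalIntegrable_sq
      (h.intervalIntegrable_sq.const_mul _) ?_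
    rw [← Measure.restrict_congr_set Ioc_ae_eq_Icc]
    refine (ae_restrict_iff' measurableSet_Ioc).2 ?_
    rw [← uIoc_of_le zero_le_one]
    refine ae_uIoc_of_ae_Ioo zero_le_one ?_
    filter_upwards [h.ae_hasDerivAt] with z hz hz1
    have h1 : HasDerivAt (fun z => mulE A (φ z)) (mulE A (deriv φ z)) z := by
      simp only [mulE_eq_toEuclideanCLM]
      exact (Matrix.toEuclideanCLM (n := Fin n) (𝕜 := ℝ) A).hasFDerivAt.comp_hasDerivAt z (hz hz1)
    rw [h1.deriv]
    exact key _

/-- Let `M` be the maximum of `|Dφ|`. The boundary condition gives `|Dφ(0)| ≤ νM + ‖DF‖|e|`, and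
`norm_sq_le_add` for `Dφ` gives `M² ≤ |Dφ(0)|² + ‖D‖²‖φ‖²` with the `H¹` norm. Since `ν < 1`, `M`
can be absorbed; returning from `Dφ` to `φ` costs `λ_min(D)²`. -/
theorem max_bound (hn : 0 < n) (hP : P.GainCond) (φ : ℝ → E n) (η : E n) (h : IsH1 φ)
    (hc : P.Compat φ η) {z : ℝ} (hz : z ∈ Icc (0 : ℝ) 1) :
    ‖φ z‖ ^ 2 ≤ P.cD * (h1NormSq φ + ‖η - φ 1‖ ^ 2) := by
  set e := η - φ 1 with he
  have hL : IsH1 (fun z => mulE P.D (φ z)) := by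
    simpa only [mulE_eq_toEuclideanCLM] using
      h.clm (Matrix.toEuclideanCLM (n := Fin n) (𝕜 := ℝ) P.D)
  obtain ⟨z0, hz0, hmax⟩ := isCompact_Icc.exists_isMaxOn (nonempty_Icc.2 zero_le_one)
    hL.continuousOn.norm
  have hmax' : ∀ y ∈ Icc (0 : ℝ) 1, ‖mulE P.D (φ y)‖ ≤ ‖mulE P.D (φ z0)‖ := fun y hy => hmax hy
  have hν := hP.ν_pos
  have hb : ‖mulE P.D (φ 0)‖ ≤ P.ν * ‖mulE P.D (φ z0)‖ + norm2 (P.D * P.F) * ‖e‖ := by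
    rw [hc.apply_zero, mulE_add, mulE_mulE P.D P.F]
    refine (norm_add_le _ _).trans (add_le_add ((norm_D_mul_le hP _).trans ?_) (norm_mulE_le _ _))
    gcongr
    exact hmax' 1 (by simp)
  have hM := hL.norm_sq_le_add (left_mem_Icc.2 zero_le_one) hz0
  have hN := h1NormSq_mulE_le h P.D
  have hh := IsH1.h1NormSq_nonneg φ
  have hF := norm2_nonneg (P.D * P.F)
  have h1 := sq_le_of_contraction (S := norm2 P.D ^ 2 * h1NormSq φ) (norm_nonneg _)
    hP.ν_pos.le hP.ν_lt_one (norm_nonneg _)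
    (by positivity) hb (hM.trans (by gcongr))
  have h2 : (norm2 (P.D * P.F) * ‖e‖) ^ 2 + norm2 P.D ^ 2 * h1NormSq φ ≤
      max (norm2 P.D ^ 2) (norm2 (P.D * P.F) ^ 2) * (h1NormSq φ + ‖e‖ ^ 2) := by
    rw [mul_pow, mul_add, add_comm]
    gcongr
    · exact le_max_left _ _
    · exact le_max_right _ _
  have h3 := norm_le_norm_D hP (φ z)
  have h4 : ‖mulE P.D (φ z)‖ ^ 2 ≤ ‖mulE P.D (φ z0)‖ ^ 2 := by
    gcongr; exact hmax' z hz
  have hd := iInf_pos_of_pos hn hP.dd_pos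
  have h5 : 0 < 1 - P.ν := by linarith [hP.ν_lt_one]
  unfold cD
  rw [div_mul_eq_mul_div, le_div_iff₀ (by positivity)]
  calc ‖φ z‖ ^ 2 * ((⨅ i, P.dd i) ^ 2 * (1 - P.ν) ^ 2)
      = (1 - P.ν) ^ 2 * ((⨅ i, P.dd i) ^ 2 * ‖φ z‖ ^ 2) := by ring
    _ ≤ (1 - P.ν) ^ 2 * ‖mulE P.D (φ z0)‖ ^ 2 := by gcongr; exact h3.trans h4
    _ ≤ _ := h1.trans h2

end LoopData

/-! ### Weak solutions of the scalar transport equation are constant along characteristics. -/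

section Transport

variable {v : ℝ → ℝ → ℝ} {lam : ℝ}

theorem hasDerivAt_integral_mul_shift (hv : Continuous (Function.uncurry v)) {ψ : ℝ → ℝ}
    (hψ : ContDiff ℝ ∞ ψ) (hc : HasCompactSupport ψ) (lam t s : ℝ) :
    HasDerivAt (fun s => ∫ z in (0 : ℝ)..1, v t z * ψ (z - lam * s))
      (-lam * ∫ z in (0 : ℝ)..1, v t z * deriv ψ (z - lam * s)) s := by
  have hv1 : Continuous (v t) := hv.comp (Continuous.prodMk_right t)
  have hψ' : Continuous (deriv ψ) := hψ.continuous_deriv (by simp)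
  have hψ0 := hψ.continuous
  obtain ⟨C, hC⟩ := hc.deriv.exists_bound_of_continuous hψ'
  rw [← intervalIntegral.integral_const_mul]
  refine (intervalIntegral.hasDerivAt_integral_of_dominated_loc_of_deriv_le
    (F' := fun s z => -lam * (v t z * deriv ψ (z - lam * s)))
    (bound := fun z => |lam| * (|v t z| * C)) univ_mem
    (Eventually.of_forall fun s => ?_) ?_ ?_ ?_ ?_ ?_).2
  · exact Continuous.aestronglyMeasurable (by fun_prop)
  · exact Continuous.intervalIntegrable (by fun_prop) _ _
  · exact Continuous.aestronglyMeasurable (by fun_prop)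
  · refine ae_of_all _ fun z _ s _ => ?_
    rw [norm_mul, norm_mul, norm_neg]
    simp only [Real.norm_eq_abs]
    gcongr
    exact hC _
  · exact Continuous.intervalIntegrable (by fun_prop) _ _
  · refine ae_of_all _ fun z _ s _ => ?_
    have h1 : HasDerivAt (fun s => z - lam * s) (-lam) s := by
      simpa using ((hasDerivAt_id s).const_mul lam).const_sub z
    have h2 := ((hψ.differentiable (by simp)) (z - lam * s)).hasDerivAt.comp s h1
    exact (h2.const_mul (v t z)).congr_deriv (by ring)

theorem tsupport_comp_sub_subset {ψ : ℝ → ℝ} {c : ℝ} (x : ℝ) (h : x ∈ tsupport fun z => ψ (z - c)) :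
    x - c ∈ tsupport ψ :=
  tsupport_comp_subset_preimage ψ (f := fun z : ℝ => z - c) (by fun_prop) h

/-- Moving the test function with speed `lam` cancels the transport: the weak equation gives the
time derivative of the pairing, the translation gives its opposite, and the pairing stays constant
along `(t + s, s)`. -/
theorem integral_mul_shift_eq (hv : Continuous (Function.uncurry v))
    (hw : ∀ ψ : ℝ → ℝ, ContDiff ℝ ∞ ψ → HasCompactSupport ψ → tsupport ψ ⊆ Ioo (0 : ℝ) 1 →
      ∀ t : ℝ, 0 ≤ t → ∫ z in (0 : ℝ)..1, v t z * ψ z = (∫ z in (0 : ℝ)..1, v 0 z * ψ z) +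
          lam * ∫ s in (0 : ℝ)..t, ∫ z in (0 : ℝ)..1, v s z * deriv ψ z)
    (hlam : 0 < lam) {t r : ℝ} (ht : 0 ≤ t) (hr : 0 < r) {ψ : ℝ → ℝ}
    (hψ : ContDiff ℝ ∞ ψ) (hc : HasCompactSupport ψ) (hs : tsupport ψ ⊆ Ioo (0 : ℝ) (1 - lam * r)) :
    ∫ z in (0 : ℝ)..1, v (t + r) z * ψ (z - lam * r) = ∫ z in (0 : ℝ)..1, v t z * ψ z := by
  have hψ' : Continuous (deriv ψ) := hψ.continuous_deriv (by simp)
  have hψ0 := hψ.continuous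
  set B : ℝ → ℝ → ℝ := fun t s => ∫ z in (0 : ℝ)..1, v t z * ψ (z - lam * s) with hB
  set B' : ℝ → ℝ → ℝ := fun t s => ∫ z in (0 : ℝ)..1, v t z * deriv ψ (z - lam * s) with hB'
  have hBc : Continuous (Function.uncurry B) := by
    refine intervalIntegral.continuous_parametric_intervalIntegral_of_continuous'
      (f := fun (p : ℝ × ℝ) z => v p.1 z * ψ (z - lam * p.2)) ?_ _ _
    have : Continuous fun q : (ℝ × ℝ) × ℝ => v q.1.1 q.2 :=
      hv.comp (continuous_fst.fst.prodMk continuous_snd)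
    simp only [Function.uncurry_def]
    fun_prop
  have hBc' : Continuous (Function.uncurry B') := by
    refine intervalIntegral.continuous_parametric_intervalIntegral_of_continuous'
      (f := fun (p : ℝ × ℝ) z => v p.1 z * deriv ψ (z - lam * p.2)) ?_ _ _
    have : Continuous fun q : (ℝ × ℝ) × ℝ => v q.1.1 q.2 :=
      hv.comp (continuous_fst.fst.prodMk continuous_snd)
    simp only [Function.uncurry_def]
    fun_prop
  -- For `s` in `(0, r)` the translated test function is still supported in `(0,1)`, so the weak
  -- equation may be tested with it.
  have hBt : ∀ a s : ℝ, 0 < a → s ∈ Ioo 0 r → HasDerivAt (fun a => B a s) (lam * B' a s) a := by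
    intro a s ha hs1
    have h1 : ∀ a : ℝ, 0 ≤ a → B a s = B 0 s + lam * ∫ b in (0 : ℝ)..a, B' b s := by
      intro a ha
      have := hw (fun z => ψ (z - lam * s)) (by fun_prop)
        (hc.comp_homeomorph (Homeomorph.subRight (lam * s))) ?_ a ha
      · simp only [deriv_comp_sub_const] at this
        exact this
      · intro x hx
        have h2 := hs (tsupport_comp_sub_subset x hx)
        have h3 := mul_pos hlam hs1.1
        have h4 := mul_lt_mul_of_pos_left hs1.2 hlam
        constructor
        · linarith [h2.1]
        · linarith [h2.2]
    have hcont : Continuous fun b => B' b s := hBc'.comp (Continuous.prodMk_left s)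
    have h2 := (((hcont.integral_hasStrictDerivAt 0 a).hasDerivAt).const_mul lam).const_add (B 0 s)
    refine h2.congr_of_eventuallyEq ?_
    filter_upwards [lt_mem_nhds ha] with b hb using h1 b hb.le
  have hBs : ∀ a s : ℝ, HasDerivAt (fun s => B a s) (-lam * B' a s) s := fun a s =>
    hasDerivAt_integral_mul_shift hv hψ hc lam a s
  have hG : ∀ s ∈ Ioo 0 r, HasDerivAt (fun s => B (t + s) s) 0 s := by
    intro s hs1
    have hopen : ∀ᶠ p : ℝ × ℝ in 𝓝 (t + s, s), 0 < p.1 ∧ p.2 ∈ Ioo 0 r := by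
      refine (Eventually.and ?_ ?_)
      · exact continuous_fst.continuousAt.eventually (lt_mem_nhds (by simpa using by linarith [hs1.1]))
      · exact continuous_snd.continuousAt.eventually (Ioo_mem_nhds hs1.1 hs1.2)
    -- Both partial derivatives are continuous, so `B` is differentiable jointly and the chain rule
    -- applies on the diagonal.
    have h := hasStrictFDerivAt_uncurry_coprod (𝕜 := ℝ) (u := (t + s, s)) (f := B)
      (f₁ := fun a b => (ContinuousLinearMap.toSpanSingleton ℝ (lam * B' a b)))
      (f₂ := fun a b => (ContinuousLinearMap.toSpanSingleton ℝ (-lam * B' a b)))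
      (by
        filter_upwards [hopen] with p hp
        exact (hBt p.1 p.2 hp.1 hp.2).hasFDerivAt)
      (by
        filter_upwards [hopen] with p hp
        exact (hBs p.1 p.2).hasFDerivAt)
      (by
        refine Continuous.continuousAt ?_
        have := (ContinuousLinearMap.toSpanSingletonCLE (𝕜 := ℝ) (E := ℝ)).continuous.comp
          (hBc'.const_smul lam)
        exact this)
      (by
        refine Continuous.continuousAt ?_
        have := (ContinuousLinearMap.toSpanSingletonCLE (𝕜 := ℝ) (E := ℝ)).continuous.comp
          (hBc'.const_smul (-lam))
        exact this)
    have h2 : HasDerivAt (fun s => (t + s, s)) ((1 : ℝ), (1 : ℝ)) s :=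
      ((hasDerivAt_id s).const_add t).prodMk (hasDerivAt_id s)
    have h3 := HasFDerivAt.comp_hasDerivAt (f := fun s => (t + s, s)) s h.hasFDerivAt h2
    exact h3.congr_deriv (by simp [Function.HasUncurry.uncurry])
  -- The mean value theorem needs only continuity at the endpoints, where the derivative is not
  -- available: `t` may be `0`.
  obtain ⟨c, hc1, hc2⟩ := exists_hasDerivAt_eq_slope (fun s => B (t + s) s) (fun _ => 0) hr
    (hBc.comp ((continuous_const.add continuous_id).prodMk continuous_id)).continuousOn hG
  have : B (t + r) r = B (t + 0) 0 := by
    rw [eq_comm, div_eq_zero_iff] at hc2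
    rcases hc2 with h | h
    · linarith
    · linarith
  simpa [hB] using this

/-- The fundamental lemma of the calculus of variations on `(0, 1 - lam r)` gives the identity a.e.;
continuity extends it to the closed interval, which must be nondegenerate, whence `lam r < 1`. -/
theorem eq_along_characteristic_of_lt (hv : Continuous (Function.uncurry v))
    (hw : ∀ ψ : ℝ → ℝ, ContDiff ℝ ∞ ψ → HasCompactSupport ψ → tsupport ψ ⊆ Ioo (0 : ℝ) 1 →
      ∀ t : ℝ, 0 ≤ t → ∫ z in (0 : ℝ)..1, v t z * ψ z = (∫ z in (0 : ℝ)..1, v 0 z * ψ z) +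
          lam * ∫ s in (0 : ℝ)..t, ∫ z in (0 : ℝ)..1, v s z * deriv ψ z)
    (hlam : 0 < lam) {t r z : ℝ} (ht : 0 ≤ t) (hr : 0 ≤ r) (hr1 : lam * r < 1) (hz : 0 ≤ z)
    (hz1 : z + lam * r ≤ 1) : v (t + r) (z + lam * r) = v t z := by
  rcases hr.eq_or_lt with rfl | hr
  · simp
  have hv1 : ∀ t, Continuous (v t) := fun t => hv.comp (Continuous.prodMk_right t)
  have hcont : Continuous fun z => v (t + r) (z + lam * r) - v t z :=
    ((hv1 _).comp (by fun_prop)).sub (hv1 t)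
  have hsupp : ∀ (ψ : ℝ → ℝ) (f : ℝ → ℝ), tsupport ψ ⊆ Ioo (0 : ℝ) 1 →
      ∫ z in (0 : ℝ)..1, f z * ψ z = ∫ z, f z * ψ z := by
    intro ψ f h
    refine intervalIntegral.integral_eq_integral_of_support_subset ?_
    exact (Function.support_mul_subset_right _ _).trans
      ((subset_tsupport ψ).trans (h.trans Ioo_subset_Ioc_self))
  have hae := IsOpen.ae_eq_zero_of_integral_contDiff_smul_eq_zero (μ := volume)
    (isOpen_Ioo (a := (0 : ℝ)) (b := 1 - lam * r))
    (hcont.locallyIntegrable.locallyIntegrableOn _) (by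
      intro ψ hψ hc hs
      have h := integral_mul_shift_eq hv hw hlam ht hr hψ hc hs
      have hlr := mul_pos hlam hr
      have hψ0 := hψ.continuous
      rw [hsupp ψ _ (hs.trans (Ioo_subset_Ioo_right (by linarith))),
        hsupp (fun z => ψ (z - lam * r)) _ (by
          intro x hx
          have h2 := hs (tsupport_comp_sub_subset x hx)
          exact ⟨by linarith [h2.1], by linarith [h2.2]⟩),
        ← integral_add_right_eq_self _ (lam * r)] at h
      simp only [add_sub_cancel_right] at h
      simp only [smul_eq_mul, mul_sub]
      rw [integral_sub, sub_eq_zero]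
      · simpa only [mul_comm] using h
      · exact Continuous.integrable_of_hasCompactSupport
          (hψ0.mul ((hv1 _).comp (by fun_prop))) hc.mul_right
      · exact Continuous.integrable_of_hasCompactSupport (hψ0.mul (hv1 t)) hc.mul_right)
  have hae2 : (fun z => v (t + r) (z + lam * r) - v t z)
      =ᵐ[volume.restrict (Icc 0 (1 - lam * r))] fun _ => 0 := by
    rw [← Measure.restrict_congr_set Ioo_ae_eq_Icc]
    exact (ae_restrict_iff' measurableSet_Ioo).2 hae
  have := Measure.eqOn_of_ae_eq hae2 hcont.continuousOn continuousOn_const (by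
    rw [interior_Icc, closure_Ioo (by linarith)]) (show z ∈ Icc 0 (1 - lam * r) from
      ⟨hz, by linarith⟩)
  exact sub_eq_zero.1 this

theorem eq_along_characteristic (hv : Continuous (Function.uncurry v))
    (hw : ∀ ψ : ℝ → ℝ, ContDiff ℝ ∞ ψ → HasCompactSupport ψ → tsupport ψ ⊆ Ioo (0 : ℝ) 1 →
      ∀ t : ℝ, 0 ≤ t → ∫ z in (0 : ℝ)..1, v t z * ψ z = (∫ z in (0 : ℝ)..1, v 0 z * ψ z) +
          lam * ∫ s in (0 : ℝ)..t, ∫ z in (0 : ℝ)..1, v s z * deriv ψ z)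
    (hlam : 0 < lam) {t r z : ℝ} (ht : 0 ≤ t) (hr : 0 ≤ r) (hz : 0 ≤ z)
    (hz1 : z + lam * r ≤ 1) : v (t + r) (z + lam * r) = v t z := by
  -- Two half steps cover the limiting case `lam * r = 1`, in which the characteristic crosses the
  -- whole domain.
  have h0 : 0 ≤ lam * (r / 2) := by positivity
  have h1 := eq_along_characteristic_of_lt hv hw hlam ht ((by linarith : 0 ≤ r / 2)) (z := z) (by linarith) hz
    (by linarith)
  have h2 := eq_along_characteristic_of_lt hv hw hlam (t := t + r / 2) (z := z + lam * (r / 2))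
    (by linarith) ((by linarith : 0 ≤ r / 2)) (by linarith) (by linarith) (by linarith)
  rw [← h1, ← h2]
  congr 1 <;> ring

end Transport

/-! ### Quadratic forms at the boundary and the use of `Ω > ζ I`. -/

section BilinearForm

variable {n : ℕ}

/-- The bilinear form `xᵀ A y`. -/
noncomputable def bform (A : Matrix (Fin n) (Fin n) ℝ) (x y : E n) : ℝ := inner ℝ x (mulE A y)

theorem bform_eq_dotProduct (A : Matrix (Fin n) (Fin n) ℝ) (x y : E n) :
    bform A x y = (fun i => x i) ⬝ᵥ (A *ᵥ fun i => y i) := by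
  simp only [bform, mulE, PiLp.inner_apply, dotProduct]
  exact Finset.sum_congr rfl fun i _ => by simp [mul_comm]

theorem bform_transpose (A : Matrix (Fin n) (Fin n) ℝ) (x y : E n) :
    bform Aᵀ x y = bform A y x := by
  rw [bform_eq_dotProduct, bform_eq_dotProduct, Matrix.mulVec_transpose, dotProduct_comm,
    Matrix.dotProduct_mulVec]

theorem inner_mulE_left (A : Matrix (Fin n) (Fin n) ℝ) (x y : E n) :
    inner ℝ (mulE A x) y = inner ℝ x (mulE Aᵀ y) := by
  rw [real_inner_comm]
  exact (bform_transpose A x y).symm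

theorem abs_bform_le (A : Matrix (Fin n) (Fin n) ℝ) (x y : E n) :
    |bform A x y| ≤ norm2 A * ‖x‖ * ‖y‖ := by
  refine (abs_real_inner_le_norm _ _).trans ?_
  calc ‖x‖ * ‖mulE A y‖ ≤ ‖x‖ * (norm2 A * ‖y‖) := by gcongr; exact norm_mulE_le _ _
    _ = _ := by ring

end BilinearForm

namespace LoopData

variable {n m : ℕ} {P : LoopData n m}

theorem bform_G (P : LoopData n m) (x y : E n) :
    bform P.G x y = inner ℝ (mulE P.D (mulE P.H x)) (mulE P.D (mulE P.F y)) := by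
  have hD : P.Dᵀ = P.D := by simp [D]
  rw [inner_mulE_left, inner_mulE_left, hD, mulE_mulE, mulE_mulE, mulE_mulE, bform, G]
  simp only [Matrix.mul_assoc]

theorem bform_Q (P : LoopData n m) (x y : E n) :
    bform P.Q x y = inner ℝ (mulE P.D (mulE P.F x)) (mulE P.D (mulE P.F y)) := by
  have hD : P.Dᵀ = P.D := by simp [D]
  rw [inner_mulE_left, inner_mulE_left, hD, mulE_mulE, mulE_mulE, mulE_mulE, bform, Q]
  simp only [Matrix.mul_assoc]

theorem bform_D_sq (P : LoopData n m) (x : E n) :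
    bform (P.D * P.D) x x = ‖mulE P.D x‖ ^ 2 := by
  have hD : P.Dᵀ = P.D := by simp [D]
  rw [← real_inner_self_eq_norm_sq, inner_mulE_left, hD, mulE_mulE, bform]

/-- The quadratic form of `Ω` is bounded below by `ζ`. -/
theorem omega_form_ge (hP : P.GainCond) (x e w : E n) :
    P.ζ * (‖x‖ ^ 2 + ‖e‖ ^ 2 + ‖w‖ ^ 2) ≤
      P.rho * P.β₁ * ‖mulE P.D x‖ ^ 2 - 2 * P.β₁ * (bform P.G x e + bform P.Q x e)
      + (2 * P.α * P.β₃ * ‖e‖ ^ 2 - (P.β₁ + P.α ^ 2 * P.β₂) * bform P.Q e e)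
      + 2 * (P.β₃ * inner ℝ e w + P.α * P.β₂ * bform P.G w e)
      + P.β₂ * (P.rho * ‖mulE P.D w‖ ^ 2 + bform P.Q w w + 2 * bform P.G w w) := by
  have h := hP.omega_gt.posSemidef.dotProduct_mulVec_nonneg
    (Sum.elim (fun i => x i) (Sum.elim (fun i => e i) (fun i => w i)))
  have hx : ∀ y : E n, (fun i => y i) ⬝ᵥ (fun i => y i) = ‖y‖ ^ 2 := fun y => by
    rw [EuclideanSpace.real_norm_sq_eq]; simp [dotProduct, sq]
  have hxy : ∀ y z : E n, (fun i => y i) ⬝ᵥ (fun i => z i) = inner ℝ y z := fun y z => by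
    simp only [PiLp.inner_apply, dotProduct]
    exact Finset.sum_congr rfl fun i _ => by simp [mul_comm]
  simp only [Omega, Matrix.sub_mulVec, Matrix.smul_mulVec, Matrix.one_mulVec, star_trivial,
    Matrix.fromBlocks_mulVec, Matrix.fromCols_mulVec, Matrix.fromRows_mulVec, dotProduct_sub,
    dotProduct_smul, Matrix.transpose_add, Matrix.transpose_smul,
    Matrix.transpose_neg, Matrix.transpose_transpose, Matrix.transpose_one, Matrix.neg_mulVec,
    Matrix.add_mulVec, Matrix.zero_mulVec,
    sumElim_dotProduct_sumElim,
    Function.comp_def, Sum.elim_inl, Sum.elim_inr, dotProduct_add,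
    dotProduct_neg, dotProduct_zero, ← bform_eq_dotProduct, hx, hxy, bform_transpose, bform_D_sq, smul_eq_mul] at h
  rw [real_inner_comm e w] at h
  linarith

/-- With `η = e + x`, the inflow is `(H + F)x + Fe`, so the damping condition bounds the part in `x`
and the rest are the cross terms of `Ω`. -/
theorem norm_sq_D_H_add_F_le (hP : P.GainCond) (x e : E n) :
    ‖mulE P.D (mulE P.H x + mulE P.F (e + x))‖ ^ 2 ≤
      P.ν ^ 2 * ‖mulE P.D x‖ ^ 2 + 2 * (bform P.G x e + bform P.Q x e) + bform P.Q e e := by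
  have h1 : mulE P.H x + mulE P.F (e + x) = mulE (P.H + P.F) x + mulE P.F e := by
    rw [mulE_add, add_mulE]; abel
  have h2 : inner ℝ (mulE P.D (mulE (P.H + P.F) x)) (mulE P.D (mulE P.F e))
      = bform P.G x e + bform P.Q x e := by
    rw [bform_G, bform_Q, add_mulE, mulE_add, inner_add_left]
  have h3 : ‖mulE P.D (mulE (P.H + P.F) x)‖ ^ 2 ≤ P.ν ^ 2 * ‖mulE P.D x‖ ^ 2 := by
    rw [← mul_pow]
    gcongr
    exact norm_D_mul_le hP x
  rw [h1, mulE_add, norm_add_sq_real, h2, bform_Q P e e, real_inner_self_eq_norm_sq]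
  linarith

/-- After differentiation in time, `w` is fed back through `H` alone. Completing `H` to `H + F` to
use the damping condition costs `2G + Q`, which explains the term `Q + G + Gᵀ` in the last block of
`Ω`. -/
theorem norm_sq_D_H_add_F_deriv_le (hP : P.GainCond) (w e d : E n) :
    ‖mulE P.D (mulE P.H w + mulE P.F (-(P.α • e) + P.α • d))‖ ^ 2 ≤
      P.ν ^ 2 * ‖mulE P.D w‖ ^ 2 - 2 * bform P.G w w - bform P.Q w w
      + 2 * P.α * (bform P.G w d - bform P.G w e)
      + P.α ^ 2 * (bform P.Q d d - 2 * bform P.Q e d + bform P.Q e e) := by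
  have h3 : ‖mulE P.D (mulE (P.H + P.F) w)‖ ^ 2 ≤ P.ν ^ 2 * ‖mulE P.D w‖ ^ 2 := by
    rw [← mul_pow]
    gcongr
    exact norm_D_mul_le hP w
  have h4 : ‖mulE P.D (mulE (P.H + P.F) w)‖ ^ 2 =
      ‖mulE P.D (mulE P.H w)‖ ^ 2 + 2 * bform P.G w w + bform P.Q w w := by
    rw [add_mulE, mulE_add, norm_add_sq_real, bform_G, bform_Q, real_inner_self_eq_norm_sq]
  have h5 : mulE P.D (mulE P.F (-(P.α • e) + P.α • d)) =
      P.α • (mulE P.D (mulE P.F d) - mulE P.D (mulE P.F e)) := by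
    have : -(P.α • e) + P.α • d = P.α • (d + (-1 : ℝ) • e) := by
      rw [smul_add]; simp [add_comm]
    rw [this, mulE_smul, mulE_smul, mulE_add, mulE_add, mulE_smul, mulE_smul, neg_one_smul,
      sub_eq_add_neg]
  have h6 : ‖mulE P.D (mulE P.F d) - mulE P.D (mulE P.F e)‖ ^ 2 =
      bform P.Q d d - 2 * bform P.Q e d + bform P.Q e e := by
    rw [norm_sub_sq_real, bform_Q, bform_Q, bform_Q, real_inner_self_eq_norm_sq,
      real_inner_self_eq_norm_sq, real_inner_comm]
  have h7 : inner ℝ (mulE P.D (mulE P.H w)) (mulE P.D (mulE P.F d) - mulE P.D (mulE P.F e)) =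
      bform P.G w d - bform P.G w e := by
    rw [inner_sub_right, bform_G, bform_G]
  rw [mulE_add, norm_add_sq_real, h5, inner_smul_right, h7, norm_smul, mul_pow, h6,
    Real.norm_eq_abs, sq_abs]
  linarith

/-- Young's inequality in the form used below. -/
theorem mul_le_young {a b c ζ : ℝ} (hζ : 0 < ζ) : 2 * a * b * c ≤ ζ * b ^ 2 + a ^ 2 / ζ * c ^ 2 := by
  have h : 0 ≤ (ζ * b - a * c) ^ 2 / ζ := by positivity
  have h2 : (ζ * b - a * c) ^ 2 / ζ = ζ * b ^ 2 + a ^ 2 / ζ * c ^ 2 - 2 * a * b * c := by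
    field_simp; ring
  linarith

/-- The pointwise dissipation inequality at the boundary. -/
theorem boundary_dissipation (hP : P.GainCond) (x e w d : E n) :
    P.β₁ * (‖mulE P.D (mulE P.H x + mulE P.F (e + x))‖ ^ 2 - Real.exp (-P.μ) * ‖mulE P.D x‖ ^ 2)
    + P.β₂ * (‖mulE P.D (mulE P.H w + mulE P.F (-(P.α • e) + P.α • d))‖ ^ 2
      - Real.exp (-P.μ) * ‖mulE P.D w‖ ^ 2)
    + 2 * P.β₃ * inner ℝ e (-(P.α • e) + P.α • d - w)
    ≤ -(P.ζ / 2) * ‖e‖ ^ 2 + P.chi * ‖d‖ ^ 2 := by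
  have hβ₁ := hP.β₁_pos
  have hβ₂ := hP.β₂_pos
  have hβ₃ := hP.β₃_pos
  have hα := hP.α_pos
  have hζ := hP.ζ_pos
  have h1 := mul_le_mul_of_nonneg_left (norm_sq_D_H_add_F_le hP x e) hβ₁.le
  have h2 := mul_le_mul_of_nonneg_left (norm_sq_D_H_add_F_deriv_le hP w e d) hβ₂.le
  have h3 := omega_form_ge hP x e w
  have h4 : inner ℝ e (-(P.α • e) + P.α • d - w) =
      -(P.α * ‖e‖ ^ 2) + P.α * inner ℝ e d - inner ℝ e w := by
    rw [inner_sub_right, inner_add_right, inner_neg_right, inner_smul_right, inner_smul_right,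
      real_inner_self_eq_norm_sq]
  -- Budget for the terms in `d`: the one with `w` uses all of `ζ|w|²`; the two with `e` use `ζ/4`
  -- each of `ζ|e|²`, leaving the `ζ/2` of the conclusion. The resulting coefficients of `|d|²` sum
  -- to `chi`; `ζ|x|²` is discarded.
  have h5 : P.β₂ * (2 * P.α * bform P.G w d) ≤
      P.ζ * ‖w‖ ^ 2 + (P.α * P.β₂ * norm2 P.G) ^ 2 / P.ζ * ‖d‖ ^ 2 := by
    refine le_trans ?_ (mul_le_young hζ)
    have := (le_abs_self _).trans (abs_bform_le P.G w d)
    calc P.β₂ * (2 * P.α * bform P.G w d) ≤ P.β₂ * (2 * P.α * (norm2 P.G * ‖w‖ * ‖d‖)) := by gcongr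
      _ = _ := by ring
  have h6 : P.β₂ * P.α ^ 2 * (-2 * bform P.Q e d) ≤
      P.ζ / 4 * ‖e‖ ^ 2 + (P.α ^ 2 * P.β₂ * norm2 P.Q) ^ 2 / (P.ζ / 4) * ‖d‖ ^ 2 := by
    refine le_trans ?_ (mul_le_young (by positivity))
    have := (neg_le_abs _).trans (abs_bform_le P.Q e d)
    calc P.β₂ * P.α ^ 2 * (-2 * bform P.Q e d) = P.β₂ * P.α ^ 2 * (2 * -bform P.Q e d) := by ring
      _ ≤ P.β₂ * P.α ^ 2 * (2 * (norm2 P.Q * ‖e‖ * ‖d‖)) := by gcongr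
      _ = _ := by ring
  have h7 : P.β₂ * P.α ^ 2 * bform P.Q d d ≤ P.α ^ 2 * P.β₂ * norm2 P.Q * ‖d‖ ^ 2 := by
    have := (le_abs_self _).trans (abs_bform_le P.Q d d)
    calc P.β₂ * P.α ^ 2 * bform P.Q d d ≤ P.β₂ * P.α ^ 2 * (norm2 P.Q * ‖d‖ * ‖d‖) := by gcongr
      _ = _ := by ring
  have h8 : 2 * P.β₃ * (P.α * inner ℝ e d) ≤
      P.ζ / 4 * ‖e‖ ^ 2 + (P.α * P.β₃) ^ 2 / (P.ζ / 4) * ‖d‖ ^ 2 := by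
    refine le_trans ?_ (mul_le_young (by positivity))
    have := real_inner_le_norm e d
    calc 2 * P.β₃ * (P.α * inner ℝ e d) ≤ 2 * P.β₃ * (P.α * (‖e‖ * ‖d‖)) := by gcongr
      _ = _ := by ring
  have h9 : P.chi * ‖d‖ ^ 2 = (P.α * P.β₂ * norm2 P.G) ^ 2 / P.ζ * ‖d‖ ^ 2
      + (P.α ^ 2 * P.β₂ * norm2 P.Q) ^ 2 / (P.ζ / 4) * ‖d‖ ^ 2
      + P.α ^ 2 * P.β₂ * norm2 P.Q * ‖d‖ ^ 2 + (P.α * P.β₃) ^ 2 / (P.ζ / 4) * ‖d‖ ^ 2 := by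
    unfold chi
    field_simp
    ring
  have h10 : 0 ≤ P.ζ * ‖x‖ ^ 2 := by positivity
  rw [h4, h9]
  simp only [rho] at h3
  linarith

end LoopData

/-! ### Change of variables between space at a fixed time and time at the inflow. -/

section Affine

variable {lam t : ℝ} {u f : ℝ → ℝ}

theorem integral_comp_affine (k : ℝ → ℝ) (hlam : lam ≠ 0) (t a b : ℝ) :
    ∫ s in a..b, k (lam * (t - s)) = lam⁻¹ * ∫ y in lam * (t - b)..lam * (t - a), k y := by
  have h1 := intervalIntegral.integral_comp_sub_left (a := a) (b := b) (fun x => k (lam * x)) t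
  have h2 := intervalIntegral.integral_comp_mul_left (a := t - b) (b := t - a) k hlam
  rw [smul_eq_mul] at h2
  exact h1.trans h2

theorem intervalIntegrable_comp_affine {k : ℝ → ℝ} (hk : IntervalIntegrable k volume 0 1)
    (lam t : ℝ) : IntervalIntegrable (fun s => k (lam * (t - s))) volume (t - 1 / lam) t := by
  have h := ((hk.comp_mul_left (c := lam)).comp_sub_left t).symm
  simpa using h

/-- Here `u` is a spatial profile at time `t` and `f` the inflow history that produced it. The
substitution `z = lam (t - s)` sends the left end of the window to `z = 1`, hence the initial value
`u 1`. -/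
theorem absolutelyContinuous_of_char (hlam : 0 < lam) (hu : AbsolutelyContinuousOnInterval u 0 1)
    (hf : ∀ s ∈ Icc (t - 1 / lam) t, f s = u (lam * (t - s))) :
    AbsolutelyContinuousOnInterval f (t - 1 / lam) t := by
  have hτ : 0 < 1 / lam := by positivity
  refine absolutelyContinuousOnInterval_of_integral (c := u 1)
    (g := fun s => -lam * deriv u (lam * (t - s)))
    ((intervalIntegrable_comp_affine hu.intervalIntegrable_deriv lam t).const_mul _) fun s hs => ?_
  rw [uIcc_of_le (by linarith)] at hs
  have h1 : lam * (t - (t - 1 / lam)) = 1 := by field_simp; ring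
  have h2 : lam * (t - s) ∈ Icc (0 : ℝ) 1 := by
    constructor
    · exact mul_nonneg hlam.le (by linarith [hs.2])
    · rw [← h1]; exact mul_le_mul_of_nonneg_left (by linarith [hs.1]) hlam.le
  rw [intervalIntegral.integral_const_mul, integral_comp_affine _ hlam.ne', h1,
    (hu.mono (uIcc_subset_uIcc_right (by rwa [uIcc_of_le zero_le_one]))).integral_deriv_eq_sub,
    hf s hs]
  field_simp
  ring

theorem deriv_of_char (hf : ∀ s ∈ Icc (t - 1 / lam) t, f s = u (lam * (t - s))) {s : ℝ}
    (hs : s ∈ Ioo (t - 1 / lam) t) : deriv f s = -lam * deriv u (lam * (t - s)) := by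
  have h1 : f =ᶠ[𝓝 s] fun s => u (lam * (t - s)) := by
    filter_upwards [Icc_mem_nhds hs.1 hs.2] with x hx using hf x hx
  rw [h1.deriv_eq, deriv_comp_const_sub (f := fun x => u (lam * x)), deriv_comp_mul_left, smul_eq_mul]
  ring

theorem intervalIntegrable_deriv_sq_of_char (hlam : 0 < lam)
    (hu : IntervalIntegrable (fun z => deriv u z ^ 2) volume 0 1)
    (hf : ∀ s ∈ Icc (t - 1 / lam) t, f s = u (lam * (t - s))) :
    IntervalIntegrable (fun s => deriv f s ^ 2) volume (t - 1 / lam) t := by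
  have hτ : 0 < 1 / lam := by positivity
  refine ((intervalIntegrable_comp_affine hu lam t).const_mul (lam ^ 2)).congr_ae ?_
  refine (ae_restrict_iff' measurableSet_uIoc).2 (ae_uIoc_of_ae_Ioo (by linarith) ?_)
  refine ae_of_all _ fun s hs => ?_
  simp only [deriv_of_char hf hs]
  ring

theorem integral_sq_of_char (hlam : 0 < lam) (μ : ℝ)
    (hf : ∀ s ∈ Icc (t - 1 / lam) t, f s = u (lam * (t - s))) :
    ∫ z in (0 : ℝ)..1, u z ^ 2 * Real.exp (-μ * z) =
      lam * ∫ s in (t - 1 / lam)..t, f s ^ 2 * Real.exp (-(μ * lam) * (t - s)) := by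
  have hτ : 0 < 1 / lam := by positivity
  have h := integral_comp_affine (fun z => u z ^ 2 * Real.exp (-μ * z)) hlam.ne' t (t - 1 / lam) t
  have h1 : lam * (t - (t - 1 / lam)) = 1 := by field_simp; ring
  rw [h1, sub_self, mul_zero] at h
  have h2 : ∫ s in (t - 1 / lam)..t, f s ^ 2 * Real.exp (-(μ * lam) * (t - s)) =
      ∫ s in (t - 1 / lam)..t, u (lam * (t - s)) ^ 2 * Real.exp (-μ * (lam * (t - s))) := by
    refine intervalIntegral.integral_congr fun s hs => ?_
    rw [uIcc_of_le (by linarith)] at hs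
    simp only [hf s hs]
    congr 2; ring
  rw [h2, h]
  field_simp

theorem integral_deriv_sq_of_char (hlam : 0 < lam) (μ : ℝ)
    (hf : ∀ s ∈ Icc (t - 1 / lam) t, f s = u (lam * (t - s))) :
    ∫ z in (0 : ℝ)..1, deriv u z ^ 2 * Real.exp (-μ * z) =
      lam⁻¹ * ∫ s in (t - 1 / lam)..t, deriv f s ^ 2 * Real.exp (-(μ * lam) * (t - s)) := by
  have hτ : 0 < 1 / lam := by positivity
  have h := integral_comp_affine (fun z => deriv u z ^ 2 * Real.exp (-μ * z)) hlam.ne' t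
    (t - 1 / lam) t
  have h1 : lam * (t - (t - 1 / lam)) = 1 := by field_simp; ring
  rw [h1, sub_self, mul_zero] at h
  have h2 : ∫ s in (t - 1 / lam)..t, deriv f s ^ 2 * Real.exp (-(μ * lam) * (t - s)) =
      ∫ s in (t - 1 / lam)..t,
        lam ^ 2 * (deriv u (lam * (t - s)) ^ 2 * Real.exp (-μ * (lam * (t - s)))) := by
    refine intervalIntegral.integral_congr_ae (ae_uIoc_of_ae_Ioo (by linarith) ?_)
    refine ae_of_all _ fun s hs => ?_
    rw [deriv_of_char hf hs, show -(μ * lam) * (t - s) = -μ * (lam * (t - s)) by ring]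
    ring
  rw [h2, intervalIntegral.integral_const_mul, h]
  field_simp

end Affine

/-! ### Gluing windows, and integrals over a moving window. -/

section Chain

variable {τ : ℝ} {f h : ℝ → ℝ}

theorem intervalIntegrable_of_windows (hτ : 0 < τ)
    (hh : ∀ t, 0 ≤ t → IntervalIntegrable h volume (t - τ) t) {T : ℝ} (hT : 0 ≤ T) :
    IntervalIntegrable h volume (-τ) T := by
  obtain ⟨N, hN⟩ := exists_nat_gt ((T + τ) / τ)
  rw [div_lt_iff₀ hτ] at hN
  -- The windows ending at `0, τ, 2τ, …` are adjacent and together cover `[-τ, T]`.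
  have h1 := IntervalIntegrable.trans_iterate (f := h) (μ := volume) (n := N)
    (a := fun k : ℕ => -τ + k * τ) (fun k _ => by
      have := hh (k * τ) (by positivity)
      convert this using 1 <;> (push_cast; ring))
  simp only [Nat.cast_zero, zero_mul, add_zero] at h1
  refine h1.mono_set ?_
  rw [uIcc_of_le (by linarith), uIcc_of_le (by linarith)]
  exact Icc_subset_Icc_right (by linarith)

/-- The formula recovering `f` from the integral of `deriv f` extends across adjacent windows by
induction, and it characterizes absolute continuity once `deriv f` is integrable. -/
theorem absolutelyContinuous_of_windows (hτ : 0 < τ)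
    (hf : ∀ t, 0 ≤ t → AbsolutelyContinuousOnInterval f (t - τ) t) {T : ℝ} (hT : 0 ≤ T) :
    AbsolutelyContinuousOnInterval f (-τ) T := by
  have hI : ∀ T, 0 ≤ T → IntervalIntegrable (deriv f) volume (-τ) T := fun T hT =>
    intervalIntegrable_of_windows hτ (fun t ht => (hf t ht).intervalIntegrable_deriv) hT
  have key : ∀ k : ℕ, ∀ s ∈ Icc (-τ) (k * τ), f s = f (-τ) + ∫ x in (-τ)..s, deriv f x := by
    intro k
    induction k with
    | zero =>
      intro s hs
      simp only [Nat.cast_zero, zero_mul] at hs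
      have := hf 0 le_rfl
      rw [zero_sub] at this
      rw [(this.mono (uIcc_subset_uIcc_left (by
        rwa [uIcc_of_le (by linarith)]))).integral_deriv_eq_sub]
      ring
    | succ k ih =>
      intro s hs
      have hk : (0 : ℝ) ≤ k * τ := by positivity
      push_cast at hs
      rcases le_total s (k * τ) with hsk | hsk
      · exact ih s ⟨hs.1, hsk⟩
      have h1 := hf ((k + 1) * τ) (by positivity)
      have h2 : (k + 1) * τ - τ = k * τ := by ring
      rw [h2] at h1
      have h3 := (h1.mono (uIcc_subset_uIcc_left (show s ∈ uIcc (k * τ) ((k + 1) * τ) by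
        rw [uIcc_of_le (by linarith)]; exact ⟨hsk, hs.2⟩))).integral_deriv_eq_sub
      have h4 := ih (k * τ) ⟨by linarith, le_rfl⟩
      have h5 := intervalIntegral.integral_add_adjacent_intervals (hI (k * τ) hk)
        ((hI (k * τ) hk).symm.trans (hI s (hk.trans hsk)))
      linarith
  refine absolutelyContinuousOnInterval_of_integral (hI T hT) (c := f (-τ)) fun s hs => ?_
  rw [uIcc_of_le (by linarith)] at hs
  obtain ⟨N, hN⟩ := exists_nat_gt (T / τ)
  rw [div_lt_iff₀ hτ] at hN
  exact key N s ⟨hs.1, by linarith [hs.2]⟩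

theorem absolutelyContinuous_comp_sub {a b τ : ℝ} (hab : a ≤ b)
    (hf : AbsolutelyContinuousOnInterval f (a - τ) (b - τ)) :
    AbsolutelyContinuousOnInterval (fun t => f (t - τ)) a b := by
  have h1 : IntervalIntegrable (fun t => deriv f (t - τ)) volume a b := by
    simpa using hf.intervalIntegrable_deriv.comp_sub_right τ
  refine absolutelyContinuousOnInterval_of_integral h1 (c := f (a - τ)) fun t ht => ?_
  rw [uIcc_of_le hab] at ht
  rw [intervalIntegral.integral_comp_sub_right (fun x => deriv f x),
    (hf.mono (uIcc_subset_uIcc_left (by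
      rw [uIcc_of_le (by linarith)]
      exact ⟨by linarith [ht.1], by linarith [ht.2]⟩))).integral_deriv_eq_sub]
  ring

/-- The weighted integral of `h` over a moving window of length `τ` is absolutely continuous. -/
theorem movingWindow_absolutelyContinuous (a : ℝ) {τ T : ℝ} (hτ : 0 < τ) (hT : 0 ≤ T)
    (hh : IntervalIntegrable h volume (-τ) T) :
    AbsolutelyContinuousOnInterval (fun t => ∫ s in (t - τ)..t, h s * Real.exp (-a * (t - s))) 0 T ∧
    ∀ᵐ t, t ∈ Ioo 0 T →
      HasDerivAt (fun t => ∫ s in (t - τ)..t, h s * Real.exp (-a * (t - s)))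
        (h t - Real.exp (-(a * τ)) * h (t - τ)
          - a * ∫ s in (t - τ)..t, h s * Real.exp (-a * (t - s))) t := by
  -- Factoring out `exp(-a t)` leaves `K t - K (t - τ)` with `K` a primitive of `k`, so only the
  -- product rule and a.e. differentiability of primitives are needed.
  set k : ℝ → ℝ := fun s => h s * Real.exp (a * s) with hk
  have hki : IntervalIntegrable k volume (-τ) T := hh.mul_continuousOn (by fun_prop)
  set K : ℝ → ℝ := fun x => ∫ s in (-τ)..x, k s with hK
  have hKac : AbsolutelyContinuousOnInterval K (-τ) T :=
    hki.absolutelyContinuousOnInterval_intervalIntegral left_mem_uIcc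
  have hKac0 : AbsolutelyContinuousOnInterval K 0 T := hKac.mono (uIcc_subset_uIcc_right (by
    rw [uIcc_of_le (by linarith)]; exact ⟨by linarith, hT⟩))
  have hKs : AbsolutelyContinuousOnInterval (fun t => K (t - τ)) 0 T := by
    refine absolutelyContinuous_comp_sub hT (hKac.mono ?_)
    rw [uIcc_of_le (by linarith), uIcc_of_le (by linarith)]
    exact Icc_subset_Icc (by linarith) (by linarith)
  have hE : ∀ t ∈ Icc 0 T, ∫ s in (t - τ)..t, h s * Real.exp (-a * (t - s)) =
      Real.exp (-a * t) * (K t - K (t - τ)) := by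
    intro t ht
    have hm : ∀ x ∈ Icc (-τ) T, IntervalIntegrable k volume (-τ) x := fun x hx =>
      hki.mono_set (uIcc_subset_uIcc_left (by rwa [uIcc_of_le (by linarith)]))
    rw [hK]
    simp only
    rw [intervalIntegral.integral_interval_sub_left
      (hm t ⟨by linarith [ht.1], ht.2⟩) (hm (t - τ) ⟨by linarith [ht.1], by linarith [ht.2]⟩),
      ← intervalIntegral.integral_const_mul]
    refine intervalIntegral.integral_congr fun s _ => ?_
    simp only [hk]
    rw [mul_left_comm, ← Real.exp_add]
    congr 2; ring
  refine ⟨?_, ?_⟩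
  · refine AbsolutelyContinuousOnInterval.congr (AbsolutelyContinuousOnInterval.mul
      (f := fun t => Real.exp (-a * t)) (g := fun t => K t - K (t - τ)) ?_ (hKac0.sub hKs))
      fun t ht => hE t (by rwa [uIcc_of_le hT] at ht)
    exact ContDiffOn.absolutelyContinuousOnInterval
      (Real.contDiff_exp.comp (contDiff_const.mul contDiff_id)).contDiffOn
  have hd1 : ∀ᵐ t, t ∈ Ioo (-τ) T → HasDerivAt K (k t) t :=
    ae_hasDerivAt_of_integral (c := 0) (by linarith) hki fun x _ => by simp [hK]
  have hd2 : ∀ᵐ t, t ∈ Ioo 0 T → HasDerivAt (fun t => K (t - τ)) (k (t - τ)) t := by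
    refine ae_hasDerivAt_of_integral (c := 0) hT (g := fun t => k (t - τ)) ?_ fun x _ => ?_
    · have hk0 : IntervalIntegrable k volume (0 - τ) (T - τ) := hki.mono_set (by
        rw [uIcc_of_le (by linarith), uIcc_of_le (by linarith)]
        exact Icc_subset_Icc (by linarith) (by linarith))
      simpa using hk0.comp_sub_right τ
    · rw [intervalIntegral.integral_comp_sub_right]
      simp [hK]
  filter_upwards [hd1, hd2] with t h1 h2 ht
  have hexp : HasDerivAt (fun t => Real.exp (-a * t)) (Real.exp (-a * t) * -a) t := by
    simpa using ((hasDerivAt_id t).const_mul (-a)).exp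
  have h3 := hexp.mul ((h1 ⟨by linarith [ht.1], ht.2⟩).sub (h2 ht))
  have h4 : HasDerivAt (fun t => ∫ s in (t - τ)..t, h s * Real.exp (-a * (t - s))) _ t :=
    h3.congr_of_eventuallyEq (by
      filter_upwards [Icc_mem_nhds ht.1 ht.2] with x hx using hE x hx)
  refine h4.congr_deriv ?_
  rw [hE t (Ioo_subset_Icc_self ht)]
  have e1 : Real.exp (-a * t) * Real.exp (a * t) = 1 := by rw [← Real.exp_add]; simp
  have e2 : Real.exp (-a * t) * Real.exp (a * (t - τ)) = Real.exp (-(a * τ)) := by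
    rw [← Real.exp_add]; congr 1; ring
  simp only [hk, Pi.sub_apply]
  linear_combination h t * e1 - h (t - τ) * e2

end Chain

/-! ### Solutions as delayed inflow, and `V` as a sum of moving windows. -/

namespace LoopData

variable {n m : ℕ} {P : LoopData n m} {Xi : ℝ → E n} {ηi : E n} {y : ℝ → E n} {X : ℝ → ℝ → E n}
  {η : ℝ → E n}

/-- The value transported into the domain at the inflow boundary: `X i (0, s)` for `s ≥ 0`, continued
to negative times by the initial state. -/
noncomputable def inflow (P : LoopData n m) (X : ℝ → ℝ → E n) (i : Fin n) (s : ℝ) : ℝ :=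
  if 0 ≤ s then X s 0 i else X 0 (-(P.lam i * s)) i

theorem inflow_of_nonneg (P : LoopData n m) (X : ℝ → ℝ → E n) (i : Fin n) {t : ℝ} (ht : 0 ≤ t) :
    inflow P X i t = X t 0 i := by
  simp [inflow, ht]

namespace IsSolution

/-- Continuity in time with values in `H¹` is uniform in `z`, and each profile is continuous in `z`.
-/
theorem continuousOn_uncurry (hS : P.IsSolution Xi ηi y X η) :
    ContinuousOn (fun p : ℝ × ℝ => X p.1 p.2) (Ici 0 ×ˢ Icc 0 1) := by
  rintro ⟨t, z⟩ ⟨ht, hz⟩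
  have h1 : Tendsto (fun p : ℝ × ℝ => Real.sqrt (2 * h1NormSq (fun z => X p.1 z - X t z)))
      (𝓝[Ici 0 ×ˢ Icc 0 1] (t, z)) (𝓝 0) := by
    have h2 : Tendsto (fun p : ℝ × ℝ => p.1) (𝓝[Ici 0 ×ˢ Icc 0 1] (t, z)) (𝓝[Ici 0] t) := by
      rw [nhdsWithin_prod_eq]
      exact tendsto_fst
    have h3 := (((hS.cont_h1 t ht).comp h2).const_mul 2).sqrt
    simpa [Function.comp_def] using h3
  have h2 : Tendsto (fun p : ℝ × ℝ => X t p.2) (𝓝[Ici 0 ×ˢ Icc 0 1] (t, z)) (𝓝 (X t z)) := by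
    have h2 : Tendsto (fun p : ℝ × ℝ => p.2) (𝓝[Ici 0 ×ˢ Icc 0 1] (t, z)) (𝓝[Icc 0 1] z) := by
      rw [nhdsWithin_prod_eq]
      exact tendsto_snd
    exact Tendsto.comp ((hS.h1 t ht).continuousOn z hz) h2
  have h3 : Tendsto (fun p : ℝ × ℝ => X p.1 p.2 - X t p.2) (𝓝[Ici 0 ×ˢ Icc 0 1] (t, z)) (𝓝 0) := by
    refine squeeze_zero_norm' ?_ h1
    filter_upwards [self_mem_nhdsWithin] with p hp
    refine Real.le_sqrt_of_sq_le ?_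
    exact ((hS.h1 p.1 hp.1).sub (hS.h1 t ht)).norm_sq_le hp.2
  have := h3.add h2
  simpa [ContinuousWithinAt] using this

theorem apply_add (hS : P.IsSolution Xi ηi y X η) (hP : P.GainCond) (i : Fin n) {t r z : ℝ}
    (ht : 0 ≤ t) (hr : 0 ≤ r) (hz : 0 ≤ z) (hz1 : z + P.lam i * r ≤ 1) :
    X (t + r) (z + P.lam i * r) i = X t z i := by
  -- Nothing is known about `X` outside `[0,∞) × [0,1]`; clamping both arguments gives a continuous
  -- extension to the plane.
  set v : ℝ → ℝ → ℝ := fun t z => X (max t 0) (max 0 (min 1 z)) i with hv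
  have hvX : ∀ t z, 0 ≤ t → z ∈ Icc (0 : ℝ) 1 → v t z = X t z i := fun t z ht hz => by
    simp only [hv, max_eq_left ht, min_eq_right hz.2, max_eq_right hz.1]
  have hvc : Continuous (Function.uncurry v) := by
    have h1 : Continuous fun p : ℝ × ℝ => X (max p.1 0) (max 0 (min 1 p.2)) :=
      hS.continuousOn_uncurry.comp_continuous
        (f := fun p : ℝ × ℝ => (max p.1 0, max 0 (min 1 p.2))) (by fun_prop) fun p =>
        ⟨mem_Ici.2 (le_max_right _ _), le_max_left _ _, max_le zero_le_one (min_le_left _ _)⟩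
    exact (EuclideanSpace.proj i : E n →L[ℝ] ℝ).continuous.comp h1
  have hlr := mul_nonneg (hP.lam_pos i).le hr
  have hint : ∀ t, 0 ≤ t → ∀ ψ : ℝ → ℝ, ∫ z in (0 : ℝ)..1, v t z * ψ z =
      ∫ z in (0 : ℝ)..1, X t z i * ψ z := fun t ht ψ => by
    refine intervalIntegral.integral_congr fun z hz => ?_
    rw [uIcc_of_le zero_le_one] at hz
    simp only [hvX t z ht hz]
  have h := eq_along_characteristic (lam := P.lam i) hvc (fun ψ hψ hc hs t ht => by
    rw [hint t ht, hint 0 le_rfl, hS.pde i ψ hψ hc hs t ht]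
    congr 2
    refine intervalIntegral.integral_congr fun s hs => ?_
    rw [uIcc_of_le ht] at hs
    exact (hint s hs.1 _).symm) (hP.lam_pos i) ht hr hz hz1
  rwa [hvX _ _ (by linarith) ⟨by linarith, hz1⟩, hvX _ _ ht ⟨hz, by linarith⟩] at h

/-- The solution is constant along characteristics, so it is a delayed copy of its inflow. -/
theorem inflow_eq (hS : P.IsSolution Xi ηi y X η) (hP : P.GainCond) (i : Fin n) {t s : ℝ}
    (ht : 0 ≤ t) (hs : s ∈ Icc (t - 1 / P.lam i) t) :
    inflow P X i s = X t (P.lam i * (t - s)) i := by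
  have hl := hP.lam_pos i
  have h1 : P.lam i * (t - s) ≤ 1 := by
    have : P.lam i * (t - s) ≤ P.lam i * (1 / P.lam i) :=
      mul_le_mul_of_nonneg_left (by linarith [hs.1]) hl.le
    rwa [mul_one_div_cancel hl.ne'] at this
  unfold inflow
  split_ifs with h
  · have := hS.apply_add hP i h (r := t - s) (z := 0) (by linarith [hs.2]) le_rfl (by linarith)
    rw [← this, add_sub_cancel, zero_add]
  · push Not at h
    have h2 : P.lam i * (t - s) = -(P.lam i * s) + P.lam i * t := by ring
    have := hS.apply_add hP i le_rfl (r := t) (z := -(P.lam i * s)) ht (by nlinarith) (by linarith)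
    rw [h2, ← this, zero_add]

theorem inflow_eq_one (hS : P.IsSolution Xi ηi y X η) (hP : P.GainCond) (i : Fin n) {t : ℝ}
    (ht : 0 ≤ t) : inflow P X i (t - 1 / P.lam i) = X t 1 i := by
  have hl := hP.lam_pos i
  have : 0 < 1 / P.lam i := by positivity
  rw [hS.inflow_eq hP i ht ⟨le_rfl, by linarith⟩, sub_sub_cancel, mul_one_div_cancel hl.ne']

end IsSolution

theorem _root_.HypQuant.IsH1.intervalIntegrable_deriv_apply_sq {φ : ℝ → E n} (h : IsH1 φ)
    (i : Fin n) : IntervalIntegrable (fun z => deriv (fun z => φ z i) z ^ 2) volume 0 1 := by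
  refine (h.intervalIntegrable_apply_sq i).congr_ae ?_
  refine (ae_restrict_iff' measurableSet_uIoc).2 (ae_uIoc_of_ae_Ioo zero_le_one ?_)
  filter_upwards [h.ae_hasDerivAt_apply i] with z hz hz1
  rw [(hz hz1).deriv]

/-- Decouples the components, which travel at different speeds. The component of the derivative and
the derivative of the component agree only almost everywhere. -/
theorem V_eq_sum (P : LoopData n m) {φ : ℝ → E n} (h : IsH1 φ) (η : E n) :
    P.V φ η = ∑ i, (P.p1 i * (∫ z in (0 : ℝ)..1, φ z i ^ 2 * Real.exp (-P.μ * z)) +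
      P.p2 i * (∫ z in (0 : ℝ)..1, deriv (fun z => φ z i) z ^ 2 * Real.exp (-P.μ * z)) +
      P.β₃ * ((η i - φ 1 i) * (η i - φ 1 i))) := by
  have hφ : ∀ i, ContinuousOn (fun z => φ z i) (Icc 0 1) := fun i =>
    (EuclideanSpace.proj i : E n →L[ℝ] ℝ).continuous.comp_continuousOn h.continuousOn
  have h1 : ∫ z in (0 : ℝ)..1, (∑ i, P.p1 i * φ z i ^ 2) * Real.exp (-P.μ * z) =
      ∑ i, P.p1 i * ∫ z in (0 : ℝ)..1, φ z i ^ 2 * Real.exp (-P.μ * z) := by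
    simp_rw [← intervalIntegral.integral_const_mul]
    rw [← intervalIntegral.integral_finsetSum]
    · refine intervalIntegral.integral_congr fun z _ => ?_
      simp only [Finset.sum_mul, mul_assoc]
    · intro i _
      refine ContinuousOn.intervalIntegrable ?_
      rw [uIcc_of_le zero_le_one]
      have := hφ i
      fun_prop
  have h2 : ∫ z in (0 : ℝ)..1, (∑ i, P.p2 i * deriv φ z i ^ 2) * Real.exp (-P.μ * z) =
      ∑ i, P.p2 i * ∫ z in (0 : ℝ)..1, deriv (fun z => φ z i) z ^ 2 * Real.exp (-P.μ * z) := by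
    simp_rw [← intervalIntegral.integral_const_mul]
    rw [← intervalIntegral.integral_finsetSum]
    · refine intervalIntegral.integral_congr_ae (ae_uIoc_of_ae_Ioo zero_le_one ?_)
      filter_upwards [ae_all_iff.2 h.ae_hasDerivAt_apply] with z hz hz1
      simp only [Finset.sum_mul, mul_assoc, (hz _ hz1).deriv]
    · intro i _
      exact ((h.intervalIntegrable_deriv_apply_sq i).mul_continuousOn (by fun_prop)).const_mul _
  unfold V
  rw [h1, h2, EuclideanSpace.real_norm_sq_eq, Finset.mul_sum, ← Finset.sum_add_distrib,
    ← Finset.sum_add_distrib]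
  refine Finset.sum_congr rfl fun i _ => ?_
  simp [sq]

/-- Energy of `h` transported by the `i`-th characteristic at time `t`. -/
noncomputable def window (P : LoopData n m) (i : Fin n) (h : ℝ → ℝ) (t : ℝ) : ℝ :=
  ∫ s in (t - 1 / P.lam i)..t, h s * Real.exp (-(P.μ * P.lam i) * (t - s))

namespace IsSolution

theorem absolutelyContinuous_inflow (hS : P.IsSolution Xi ηi y X η) (hP : P.GainCond) (i : Fin n)
    {T : ℝ} (hT : 0 ≤ T) :
    AbsolutelyContinuousOnInterval (inflow P X i) (-(1 / P.lam i)) T := by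
  have hl := hP.lam_pos i
  exact absolutelyContinuous_of_windows (by positivity) (fun t ht =>
    absolutelyContinuous_of_char hl ((hS.h1 t ht).absolutelyContinuous i)
      fun s hs => hS.inflow_eq hP i ht hs) hT

theorem intervalIntegrable_deriv_inflow_sq (hS : P.IsSolution Xi ηi y X η) (hP : P.GainCond)
    (i : Fin n) {T : ℝ} (hT : 0 ≤ T) :
    IntervalIntegrable (fun s => deriv (inflow P X i) s ^ 2) volume (-(1 / P.lam i)) T := by
  have hl := hP.lam_pos i
  exact intervalIntegrable_of_windows (by positivity) (fun t ht =>
    intervalIntegrable_deriv_sq_of_char hl ((hS.h1 t ht).intervalIntegrable_deriv_apply_sq i)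
      fun s hs => hS.inflow_eq hP i ht hs) hT

/-- The powers of `Λ` in `P₁` and `P₂` are chosen to cancel the Jacobian and the factor from `∂_z =
-Λ⁻¹ ∂_s`. The weights in time are `β₁D²` and `β₂D²`, and the decay over a full window is `exp(-μ)`
for every component. -/
theorem V_eq (hS : P.IsSolution Xi ηi y X η) (hP : P.GainCond) {t : ℝ} (ht : 0 ≤ t) :
    P.V (X t) (η t) = ∑ i, (P.β₁ * P.dd i ^ 2 * P.window i (fun s => inflow P X i s ^ 2) t +
      P.β₂ * P.dd i ^ 2 * P.window i (fun s => deriv (inflow P X i) s ^ 2) t +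
      P.β₃ * ((η t i - inflow P X i (t - 1 / P.lam i)) *
        (η t i - inflow P X i (t - 1 / P.lam i)))) := by
  rw [P.V_eq_sum (hS.h1 t ht)]
  refine Finset.sum_congr rfl fun i _ => ?_
  have hl := hP.lam_pos i
  rw [integral_sq_of_char hl P.μ (u := fun z => X t z i) fun s hs => hS.inflow_eq hP i ht hs,
    integral_deriv_sq_of_char hl P.μ (u := fun z => X t z i) fun s hs => hS.inflow_eq hP i ht hs,
    hS.inflow_eq_one hP i ht, p1, p2, window, window]
  field_simp

theorem intervalIntegrable_ode (hS : P.IsSolution Xi ηi y X η) {T : ℝ} (hT : 0 ≤ T) :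
    IntervalIntegrable (fun s => -(P.α • η s) + P.α • y s) volume 0 T := by
  have h1 : IntervalIntegrable η volume 0 T := by
    refine (hS.cont_eta.mono ?_).intervalIntegrable
    rw [uIcc_of_le hT]
    exact Icc_subset_Ici_self
  have h2 : IntervalIntegrable y volume 0 T := by
    rw [intervalIntegrable_iff_integrableOn_Icc_of_le hT]
    exact (hS.meas T hT).integrable le_top
  exact ((h1.smul P.α).neg).add (h2.smul P.α)

theorem ae_hasDerivAt_eta (hS : P.IsSolution Xi ηi y X η) {T : ℝ} (hT : 0 ≤ T) :
    ∀ᵐ t, t ∈ Ioo 0 T → HasDerivAt η (-(P.α • η t) + P.α • y t) t :=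
  ae_hasDerivAt_of_integral hT (hS.intervalIntegrable_ode hT) fun t ht => hS.ode t ht.1

theorem absolutelyContinuous_eta (hS : P.IsSolution Xi ηi y X η) {T : ℝ} (hT : 0 ≤ T) (i : Fin n) :
    AbsolutelyContinuousOnInterval (fun t => η t i) 0 T := by
  have h := hS.intervalIntegrable_ode hT
  have hi : IntervalIntegrable (fun s => (-(P.α • η s) + P.α • y s) i) volume 0 T := by
    rw [intervalIntegrable_iff] at h ⊢
    exact (EuclideanSpace.proj i : E n →L[ℝ] ℝ).integrable_comp h
  refine absolutelyContinuousOnInterval_of_integral hi (c := ηi i) fun t ht => ?_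
  rw [uIcc_of_le hT] at ht
  have h2 := (EuclideanSpace.proj i : E n →L[ℝ] ℝ).intervalIntegral_comp_comm
    (h.mono_set (uIcc_subset_uIcc_left (show t ∈ uIcc 0 T by rwa [uIcc_of_le hT])))
  simp only [EuclideanSpace.coe_proj] at h2
  rw [h2, hS.ode t ht.1]
  simp

theorem absolutelyContinuous_outflow (hS : P.IsSolution Xi ηi y X η) (hP : P.GainCond) {T : ℝ}
    (hT : 0 ≤ T) (i : Fin n) :
    AbsolutelyContinuousOnInterval (fun t => inflow P X i (t - 1 / P.lam i)) 0 T := by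
  have hl := hP.lam_pos i
  have hτ : 0 < 1 / P.lam i := by positivity
  refine absolutelyContinuous_comp_sub hT ((hS.absolutelyContinuous_inflow hP i hT).mono ?_)
  rw [uIcc_of_le (by linarith), uIcc_of_le (by linarith)]
  exact Icc_subset_Icc (by linarith) (by linarith)

theorem window_sq (hS : P.IsSolution Xi ηi y X η) (hP : P.GainCond) {T : ℝ}
    (hT : 0 ≤ T) (i : Fin n) :
    AbsolutelyContinuousOnInterval (P.window i (fun s => inflow P X i s ^ 2)) 0 T ∧
    ∀ᵐ t, t ∈ Ioo 0 T → HasDerivAt (P.window i (fun s => inflow P X i s ^ 2))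
      (inflow P X i t ^ 2 - Real.exp (-P.μ) * inflow P X i (t - 1 / P.lam i) ^ 2
        - P.μ * P.lam i * P.window i (fun s => inflow P X i s ^ 2) t) t := by
  have hl := hP.lam_pos i
  have h := movingWindow_absolutelyContinuous (h := fun s => inflow P X i s ^ 2) (P.μ * P.lam i)
    (by positivity : 0 < 1 / P.lam i) hT
    (((hS.absolutelyContinuous_inflow hP i hT).continuousOn.pow 2).intervalIntegrable)
  rwa [show P.μ * P.lam i * (1 / P.lam i) = P.μ by field_simp] at h

theorem window_deriv_sq (hS : P.IsSolution Xi ηi y X η) (hP : P.GainCond) {T : ℝ}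
    (hT : 0 ≤ T) (i : Fin n) :
    AbsolutelyContinuousOnInterval (P.window i (fun s => deriv (inflow P X i) s ^ 2)) 0 T ∧
    ∀ᵐ t, t ∈ Ioo 0 T → HasDerivAt (P.window i (fun s => deriv (inflow P X i) s ^ 2))
      (deriv (inflow P X i) t ^ 2
        - Real.exp (-P.μ) * deriv (inflow P X i) (t - 1 / P.lam i) ^ 2
        - P.μ * P.lam i * P.window i (fun s => deriv (inflow P X i) s ^ 2) t) t := by
  have hl := hP.lam_pos i
  have h := movingWindow_absolutelyContinuous (h := fun s => deriv (inflow P X i) s ^ 2)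
    (P.μ * P.lam i) (by positivity : 0 < 1 / P.lam i) hT
    (hS.intervalIntegrable_deriv_inflow_sq hP i hT)
  rwa [show P.μ * P.lam i * (1 / P.lam i) = P.μ by field_simp] at h

theorem absolutelyContinuous_V (hS : P.IsSolution Xi ηi y X η) (hP : P.GainCond) {T : ℝ}
    (hT : 0 ≤ T) : AbsolutelyContinuousOnInterval (fun t => P.V (X t) (η t)) 0 T := by
  refine AbsolutelyContinuousOnInterval.congr (AbsolutelyContinuousOnInterval.sum (s := Finset.univ)
    fun i _ => (((hS.window_sq hP hT i).1.const_mul (P.β₁ * P.dd i ^ 2)).add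
      ((hS.window_deriv_sq hP hT i).1.const_mul (P.β₂ * P.dd i ^ 2))).add
      (AbsolutelyContinuousOnInterval.const_mul P.β₃ (AbsolutelyContinuousOnInterval.mul
        ((hS.absolutelyContinuous_eta hT i).sub (hS.absolutelyContinuous_outflow hP hT i))
        ((hS.absolutelyContinuous_eta hT i).sub (hS.absolutelyContinuous_outflow hP hT i)))))
    fun t ht => ?_
  rw [uIcc_of_le hT] at ht
  exact hS.V_eq hP ht.1

end IsSolution

end LoopData

/-! ### The dissipation inequality. -/

namespace LoopData

variable {n m : ℕ} {P : LoopData n m} {Xi : ℝ → E n} {ηi : E n} {y : ℝ → E n} {X : ℝ → ℝ → E n}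
  {η : ℝ → E n}

theorem norm_sq_mulE_D (P : LoopData n m) (x : E n) :
    ‖mulE P.D x‖ ^ 2 = ∑ i, P.dd i ^ 2 * x i ^ 2 := by
  rw [EuclideanSpace.real_norm_sq_eq]
  exact Finset.sum_congr rfl fun i _ => by rw [D, mulE_diagonal_apply, mul_pow]

theorem window_nonneg (hP : P.GainCond) (i : Fin n) {h : ℝ → ℝ} (hh : ∀ s, 0 ≤ h s) (t : ℝ) :
    0 ≤ P.window i h t := by
  have := hP.lam_pos i
  have : 0 < 1 / P.lam i := by positivity
  exact intervalIntegral.integral_nonneg (by linarith) fun s _ =>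
    mul_nonneg (hh s) (Real.exp_pos _).le

/-- The velocity of the outgoing boundary value `X (1, ·)`. -/
noncomputable def outflowDeriv (P : LoopData n m) (X : ℝ → ℝ → E n) (t : ℝ) : E n :=
  WithLp.toLp 2 fun i => deriv (inflow P X i) (t - 1 / P.lam i)

theorem outflowDeriv_apply (P : LoopData n m) (X : ℝ → ℝ → E n) (t : ℝ) (i : Fin n) :
    outflowDeriv P X t i = deriv (inflow P X i) (t - 1 / P.lam i) := rfl

namespace IsSolution

theorem ae_hasDerivAt_outflow (hS : P.IsSolution Xi ηi y X η) (hP : P.GainCond) {T : ℝ}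
    (hT : 0 ≤ T) (i : Fin n) :
    ∀ᵐ t, t ∈ Ioo 0 T → HasDerivAt (fun t => inflow P X i (t - 1 / P.lam i))
      (outflowDeriv P X t i) t := by
  filter_upwards [(hS.absolutelyContinuous_outflow hP hT i).ae_differentiableAt] with t ht ht1
  rw [uIcc_of_le hT] at ht
  have := (ht (Ioo_subset_Icc_self ht1)).hasDerivAt
  rwa [deriv_comp_sub_const] at this

/-- The boundary condition, differentiated in time. -/
theorem deriv_inflow (hS : P.IsSolution Xi ηi y X η) (hP : P.GainCond) {t : ℝ} (ht : 0 < t)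
    {η' : E n} (hη : HasDerivAt η η' t)
    (hx : ∀ i, HasDerivAt (fun t => inflow P X i (t - 1 / P.lam i)) (outflowDeriv P X t i) t)
    (i : Fin n) :
    deriv (inflow P X i) t = (mulE P.H (outflowDeriv P X t) + mulE P.F η') i := by
  have hη' : ∀ j, HasDerivAt (fun t => η t j) (η' j) t := fun j =>
    (EuclideanSpace.proj j : E n →L[ℝ] ℝ).hasFDerivAt.comp_hasDerivAt t hη
  have h1 : HasDerivAt (fun t => (∑ j, P.H i j * inflow P X j (t - 1 / P.lam j)) +
      ∑ j, P.F i j * η t j) ((∑ j, P.H i j * outflowDeriv P X t j) + ∑ j, P.F i j * η' j) t :=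
    (HasDerivAt.fun_sum fun j _ => (hx j).const_mul _).add
      (HasDerivAt.fun_sum fun j _ => (hη' j).const_mul _)
  refine (h1.congr_of_eventuallyEq ?_).deriv
  filter_upwards [lt_mem_nhds ht] with s hs
  have h2 := congrArg (fun x : E n => x i) (hS.bdry s hs.le)
  rw [inflow_of_nonneg P X i hs.le, h2]
  simp only [PiLp.add_apply, mulE_apply, F]
  congr 1
  exact Finset.sum_congr rfl fun j _ => by rw [hS.inflow_eq_one hP j hs.le]

end IsSolution

/-- The windows contribute decay at rates `μ λᵢ` and end values at inflow and outflow. The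
differentiated boundary condition expresses the inflow in `x = X(1,t)`, `e = η - x`, `w = ẋ` and
`d`, so the end values together with the derivative of `β₃|e|²` are exactly the left side of
`boundary_dissipation`. -/
theorem deriv_V_le (hP : P.GainCond) {d : ℝ → E n}
    (hS : P.IsSolution Xi ηi (fun t => X t 1 + d t) X η) {T : ℝ} (hT : 0 ≤ T) :
    ∀ᵐ t, t ∈ Ioo 0 T → deriv (fun t => P.V (X t) (η t)) t ≤
      -P.sigma * P.V (X t) (η t) + P.chi * ‖d t‖ ^ 2 := by
  filter_upwards [hS.ae_hasDerivAt_eta hT, ae_all_iff.2 (hS.ae_hasDerivAt_outflow hP hT),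
    ae_all_iff.2 fun i => (hS.window_sq hP hT i).2,
    ae_all_iff.2 fun i => (hS.window_deriv_sq hP hT i).2] with t hη hx hW hW' ht
  replace hη := hη ht
  replace hx := fun i => hx i ht
  have ht0 : 0 ≤ t := ht.1.le
  set x : E n := X t 1 with hx1
  set e : E n := η t - x with he
  set w : E n := outflowDeriv P X t with hw
  have hη1 : -(P.α • η t) + P.α • (x + d t) = -(P.α • e) + P.α • d t := by
    rw [he, smul_sub, smul_add]; abel
  rw [hη1] at hη
  set η' : E n := -(P.α • e) + P.α • d t with hη'
  set W1 : Fin n → ℝ := fun i => P.window i (fun s => inflow P X i s ^ 2) t with hW1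
  set W2 : Fin n → ℝ := fun i => P.window i (fun s => deriv (inflow P X i) s ^ 2) t with hW2
  have hηi : ∀ j, HasDerivAt (fun t => η t j) (η' j) t := fun j =>
    (EuclideanSpace.proj j : E n →L[ℝ] ℝ).hasFDerivAt.comp_hasDerivAt t hη
  have hout : ∀ i, inflow P X i (t - 1 / P.lam i) = x i := fun i => hS.inflow_eq_one hP i ht0
  have hVd : HasDerivAt (fun t => P.V (X t) (η t)) _ t :=
    HasDerivAt.congr_of_eventuallyEq (HasDerivAt.fun_sum (u := Finset.univ) fun i _ =>
      (((hW i ht).const_mul (P.β₁ * P.dd i ^ 2)).add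
        ((hW' i ht).const_mul (P.β₂ * P.dd i ^ 2))).add
        ((((hηi i).fun_sub (hx i)).fun_mul ((hηi i).fun_sub (hx i))).const_mul P.β₃)) (by
      filter_upwards [lt_mem_nhds ht.1] with s hs
      exact hS.V_eq hP hs.le)
  rw [hVd.deriv, hS.V_eq hP ht0]
  have hx0 : mulE P.H x + mulE P.F (e + x) = X t 0 := by
    rw [hS.bdry t ht0, he, sub_add_cancel, F]
  have hb := boundary_dissipation hP x e w (d t)
  rw [hx0, ← hη', norm_sq_mulE_D, norm_sq_mulE_D, norm_sq_mulE_D, norm_sq_mulE_D] at hb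
  have hin : ∀ a b : E n, inner ℝ a b = ∑ i, a i * b i := fun a b => by
    simp only [PiLp.inner_apply]
    exact Finset.sum_congr rfl fun i _ => by simp [mul_comm]
  -- The two entries of the minimum `sigma` serve the two parts of `V`: window decay, and the
  -- `-(ζ/2)|e|²` left at the boundary.
  have hσ1 : ∀ i, P.sigma ≤ P.μ * P.lam i := fun i => (min_le_left _ _).trans
    (mul_le_mul_of_nonneg_left (iInf_le_apply _ i) hP.μ_pos.le)
  have hσ2 : P.sigma * P.β₃ ≤ P.ζ / 2 := by
    have h := mul_le_mul_of_nonneg_right (min_le_right (P.μ * ⨅ i, P.lam i) (P.ζ / (2 * P.β₃)))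
      hP.β₃_pos.le
    have h3 := hP.β₃_pos
    have h4 : P.ζ / (2 * P.β₃) * P.β₃ = P.ζ / 2 := by field_simp
    rw [h4] at h
    exact h
  have hW1n : ∀ i, 0 ≤ W1 i := fun i => window_nonneg hP i (fun s => sq_nonneg _) t
  have hW2n : ∀ i, 0 ≤ W2 i := fun i => window_nonneg hP i (fun s => sq_nonneg _) t
  have hdecay : P.sigma * ∑ i, (P.β₁ * P.dd i ^ 2 * W1 i + P.β₂ * P.dd i ^ 2 * W2 i) ≤
      ∑ i, P.μ * P.lam i * (P.β₁ * P.dd i ^ 2 * W1 i + P.β₂ * P.dd i ^ 2 * W2 i) := by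
    rw [Finset.mul_sum]
    refine Finset.sum_le_sum fun i _ => mul_le_mul_of_nonneg_right (hσ1 i) ?_
    have := hP.β₁_pos; have := hP.β₂_pos; have := hW1n i; have := hW2n i
    positivity
  have he3 : P.sigma * (P.β₃ * ‖e‖ ^ 2) ≤ P.ζ / 2 * ‖e‖ ^ 2 := by
    rw [← mul_assoc]; gcongr
  have hsumV : ∑ i, (P.β₁ * P.dd i ^ 2 * W1 i + P.β₂ * P.dd i ^ 2 * W2 i +
      P.β₃ * ((η t i - inflow P X i (t - 1 / P.lam i)) *
        (η t i - inflow P X i (t - 1 / P.lam i)))) =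
      (∑ i, (P.β₁ * P.dd i ^ 2 * W1 i + P.β₂ * P.dd i ^ 2 * W2 i)) + P.β₃ * ‖e‖ ^ 2 := by
    rw [Finset.sum_add_distrib, EuclideanSpace.real_norm_sq_eq, Finset.mul_sum]
    congr 1
    refine Finset.sum_congr rfl fun i _ => ?_
    rw [hout, he]
    simp [sq]
  have hdi := hS.deriv_inflow hP ht.1 hη hx
  rw [hsumV]
  refine le_trans (le_of_eq ?_) (show
    P.β₁ * (∑ i, P.dd i ^ 2 * X t 0 i ^ 2 - Real.exp (-P.μ) * ∑ i, P.dd i ^ 2 * x i ^ 2) +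
    P.β₂ * (∑ i, P.dd i ^ 2 * (mulE P.H w + mulE P.F η') i ^ 2
      - Real.exp (-P.μ) * ∑ i, P.dd i ^ 2 * w i ^ 2) + 2 * P.β₃ * inner ℝ e (η' - w)
    - ∑ i, P.μ * P.lam i * (P.β₁ * P.dd i ^ 2 * W1 i + P.β₂ * P.dd i ^ 2 * W2 i) ≤ _ by linarith)
  rw [hin]
  simp only [Finset.mul_sum, ← Finset.sum_add_distrib, ← Finset.sum_sub_distrib]
  refine Finset.sum_congr rfl fun i _ => ?_
  rw [hdi i, hout, inflow_of_nonneg P X i ht0]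
  simp only [← outflowDeriv_apply, ← hw, he, PiLp.sub_apply, hW1, hW2]
  ring

theorem dissipation (hP : P.GainCond) : P.Dissipation P.sigma P.chi := by
  intro Xi ηi d X η hd hS s t hs hst
  have ht : 0 ≤ t := hs.trans hst
  have hsub : uIcc s t ⊆ uIcc 0 t := by
    rw [uIcc_of_le hst, uIcc_of_le ht]; exact Icc_subset_Icc_left hs
  have hac := (hS.absolutelyContinuous_V hP ht).mono hsub
  have hdi : IntervalIntegrable (fun r => P.chi * ‖d r‖ ^ 2) volume s t := by
    have h1 : IntervalIntegrable (fun r => ‖d r‖ ^ 2) volume 0 t := by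
      rw [intervalIntegrable_iff_integrableOn_Icc_of_le ht]
      exact ((hd t ht).mono_exponent (p := 2) le_top).integrable_norm_pow (by norm_num)
    exact (h1.mono_set hsub).const_mul _
  have h := intervalIntegral.integral_mono_ae_restrict hst hac.intervalIntegrable_deriv
    ((hac.continuousOn.intervalIntegrable.const_mul (-P.sigma)).add hdi) (by
      rw [← Measure.restrict_congr_set Ioo_ae_eq_Icc]
      refine (ae_restrict_iff' measurableSet_Ioo).2 ?_
      filter_upwards [deriv_V_le hP hS ht] with r hr hr1
      exact hr ⟨hs.trans_lt hr1.1, hr1.2⟩)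
  rw [hac.integral_deriv_eq_sub] at h
  linarith

theorem admissible (hn : 0 < n) (hP : P.GainCond) :
    P.Admissible P.cP P.cD P.sigma P.chi where
  cP_pos := cP_pos hn hP
  cD_pos := cD_pos hn hP
  σ_pos := sigma_pos hn hP
  χ_pos := chi_pos hP
  coercive := coercive hP
  max_bound φ η h hc _ hz := max_bound hn hP φ η h hc hz
  dissip := dissipation hP

end LoopData

/-! ### Perturbing one component: expansion of weighted `H¹` energies. -/

section Variation

variable {n : ℕ}

/-- Weighted `H¹` energy. -/
noncomputable def energy (p q : Fin n → ℝ) (μ : ℝ) (φ : ℝ → E n) : ℝ :=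
  (∫ z in (0 : ℝ)..1, (∑ j, p j * φ z j ^ 2) * Real.exp (-μ * z)) +
    ∫ z in (0 : ℝ)..1, (∑ j, q j * deriv φ z j ^ 2) * Real.exp (-μ * z)

/-- The polar form of `energy` for a perturbation `ψ` of the `i`-th component. -/
noncomputable def energyCross (p q μ : ℝ) (i : Fin n) (φ : ℝ → E n) (ψ : ℝ → ℝ) : ℝ :=
  p * (∫ z in (0 : ℝ)..1, φ z i * ψ z * Real.exp (-μ * z)) +
    q * ∫ z in (0 : ℝ)..1, deriv φ z i * deriv ψ z * Real.exp (-μ * z)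

/-- `energy` of the perturbation itself. -/
noncomputable def energyScalar (p q μ : ℝ) (ψ : ℝ → ℝ) : ℝ :=
  p * (∫ z in (0 : ℝ)..1, ψ z ^ 2 * Real.exp (-μ * z)) +
    q * ∫ z in (0 : ℝ)..1, deriv ψ z ^ 2 * Real.exp (-μ * z)

theorem h1NormSq_eq_energy (φ : ℝ → E n) : h1NormSq φ = energy 1 1 0 φ := by
  simp [h1NormSq, energy, EuclideanSpace.real_norm_sq_eq]

theorem integral_quadratic_add_single {g : ℝ → E n} {χ k : ℝ → ℝ} (p : Fin n → ℝ) (i : Fin n)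
    (t : ℝ) (hg : ∀ j, IntervalIntegrable (fun z => g z j ^ 2) volume 0 1)
    (hgi : IntervalIntegrable (fun z => g z i) volume 0 1) (hχ : Continuous χ) (hk : Continuous k) :
    ∫ z in (0 : ℝ)..1, (∑ j, p j * (g z + t • EuclideanSpace.single i (χ z)) j ^ 2) * k z =
      (∫ z in (0 : ℝ)..1, (∑ j, p j * g z j ^ 2) * k z) +
      2 * t * (p i * ∫ z in (0 : ℝ)..1, g z i * χ z * k z) +
      t ^ 2 * (p i * ∫ z in (0 : ℝ)..1, χ z ^ 2 * k z) := by
  have h1 : IntervalIntegrable (fun z => (∑ j, p j * g z j ^ 2) * k z) volume 0 1 := by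
    refine IntervalIntegrable.mul_continuousOn ?_ hk.continuousOn
    rw [show (fun z => ∑ j, p j * g z j ^ 2) = ∑ j, fun z => p j * g z j ^ 2 by ext z; simp]
    exact IntervalIntegrable.sum Finset.univ (fun j _ => (hg j).const_mul (p j))
  have h2 : IntervalIntegrable (fun z => g z i * χ z * k z) volume 0 1 :=
    (hgi.mul_continuousOn hχ.continuousOn).mul_continuousOn hk.continuousOn
  have h3 : IntervalIntegrable (fun z => χ z ^ 2 * k z) volume 0 1 :=
    Continuous.intervalIntegrable (by fun_prop) _ _
  rw [← mul_assoc, ← mul_assoc, ← intervalIntegral.integral_const_mul,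
    ← intervalIntegral.integral_const_mul, ← intervalIntegral.integral_add h1 (h2.const_mul _),
    ← intervalIntegral.integral_add (h1.add (h2.const_mul _)) (h3.const_mul _)]
  refine intervalIntegral.integral_congr fun z _ => ?_
  have h4 : ∑ j, p j * (g z + t • EuclideanSpace.single i (χ z)) j ^ 2 =
      (∑ j, p j * g z j ^ 2) + (2 * t * p i * (g z i * χ z) + t ^ 2 * p i * χ z ^ 2) := by
    have h5 : ∀ j, p j * (g z + t • EuclideanSpace.single i (χ z)) j ^ 2 = p j * g z j ^ 2 +
        if j = i then 2 * t * p i * (g z i * χ z) + t ^ 2 * p i * χ z ^ 2 else 0 := by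
      intro j
      by_cases hj : j = i
      · subst hj
        simp
        ring
      · simp [hj]
    simp only [h5, Finset.sum_add_distrib, Finset.sum_ite_eq', Finset.mem_univ, if_true]
  simp only [h4]
  ring

theorem single_eq_smul (i : Fin n) (a : ℝ) :
    (EuclideanSpace.single i a : E n) = a • EuclideanSpace.single i 1 := by
  ext j
  by_cases hj : j = i
  · subst hj; simp
  · simp [hj]

theorem isH1_single (i : Fin n) {ψ : ℝ → ℝ} (hψ : ContDiff ℝ ∞ ψ) :
    IsH1 (fun z => EuclideanSpace.single i (ψ z)) := by
  refine IsH1.of_contDiff ?_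
  simp only [single_eq_smul i (ψ _)]
  exact (hψ.of_le (by exact_mod_cast le_top)).smul contDiff_const

theorem energy_add_single {φ : ℝ → E n} (h : IsH1 φ) (p q : Fin n → ℝ) (μ t : ℝ) (i : Fin n)
    {ψ : ℝ → ℝ} (hψ : ContDiff ℝ ∞ ψ) :
    energy p q μ (fun z => φ z + t • EuclideanSpace.single i (ψ z)) =
      energy p q μ φ + 2 * t * energyCross (p i) (q i) μ i φ ψ +
        t ^ 2 * energyScalar (p i) (q i) μ ψ := by
  have hφ : ∀ j, ContinuousOn (fun z => φ z j) (uIcc 0 1) := fun j => by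
    rw [uIcc_of_le zero_le_one]
    exact (EuclideanSpace.proj j : E n →L[ℝ] ℝ).continuous.comp_continuousOn h.continuousOn
  have hk : Continuous fun z : ℝ => Real.exp (-μ * z) := by fun_prop
  have h1 := integral_quadratic_add_single (g := φ) p i t
    (fun j => ((hφ j).pow 2).intervalIntegrable) (hφ i).intervalIntegrable hψ.continuous hk
  have h2 := integral_quadratic_add_single (g := deriv φ) q i t
    h.intervalIntegrable_apply_sq (h.intervalIntegrable_apply i)
    (hψ.continuous_deriv (by simp)) hk
  have h3 : ∫ z in (0 : ℝ)..1, (∑ j, q j *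
        deriv (fun z => φ z + t • EuclideanSpace.single i (ψ z)) z j ^ 2) * Real.exp (-μ * z) =
      ∫ z in (0 : ℝ)..1, (∑ j, q j *
        (deriv φ z + t • EuclideanSpace.single i (deriv ψ z)) j ^ 2) * Real.exp (-μ * z) := by
    refine intervalIntegral.integral_congr_ae (ae_uIoc_of_ae_Ioo zero_le_one ?_)
    filter_upwards [h.ae_hasDerivAt] with z hz hz1
    have hs : HasDerivAt (fun z => (EuclideanSpace.single i (ψ z) : E n))
        (EuclideanSpace.single i (deriv ψ z)) z := by
      simp only [single_eq_smul i (ψ _), single_eq_smul i (deriv ψ _)]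
      exact (hψ.differentiable (by simp) z).hasDerivAt.smul_const _
    have h4 : HasDerivAt (fun z => φ z + t • EuclideanSpace.single i (ψ z)) _ z :=
      (hz hz1).add (hs.const_smul t)
    rw [h4.deriv]
  unfold energy energyCross energyScalar
  rw [h3, h1, h2]
  ring

/-- Stationarity at a minimum: without a constant term the discriminant is `(2a)²`. -/
theorem eq_zero_of_quadratic_nonneg {a b : ℝ} (h : ∀ t : ℝ, 0 ≤ 2 * t * a + t ^ 2 * b) : a = 0 := by
  have hd : discrim b (2 * a) 0 ≤ 0 := discrim_le_zero fun t => by nlinarith [h t]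
  unfold discrim at hd
  nlinarith [sq_nonneg a]

end Variation

/-! ### Coercivity and the maximum bound are never sharp at the same state. -/

namespace LoopData

variable {n m : ℕ} {P : LoopData n m}

theorem V_eq_energy (P : LoopData n m) (φ : ℝ → E n) (η : E n) :
    P.V φ η = energy P.p1 P.p2 P.μ φ + P.β₃ * ‖η - φ 1‖ ^ 2 := rfl

/-- At a point where both inequalities of admissibility are equalities, the first variations
agree. -/
theorem first_variation {cP cD σ χ : ℝ} (hA : P.Admissible cP cD σ χ) {φ : ℝ → E n} {η : E n}
    (h : IsH1 φ) (hc : P.Compat φ η)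
    (hV : P.V φ η = cP * (h1NormSq φ + ‖η - φ 1‖ ^ 2))
    (hN : ‖φ 1‖ ^ 2 = cD * (h1NormSq φ + ‖η - φ 1‖ ^ 2)) (i : Fin n) {ψ : ℝ → ℝ}
    (hψ : ContDiff ℝ ∞ ψ) :
    energyCross (P.p1 i) (P.p2 i) P.μ i φ ψ = cP * energyCross 1 1 0 i φ ψ ∧
    (ψ 0 = 0 → ψ 1 = 0 → energyCross 1 1 0 i φ ψ = 0) := by
  have hH : ∀ t : ℝ, IsH1 (fun z => φ z + t • EuclideanSpace.single i (ψ z)) := fun t =>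
    h.add_smul (isH1_single i hψ) t
  constructor
  · refine sub_eq_zero.1 (eq_zero_of_quadratic_nonneg
      (b := energyScalar (P.p1 i) (P.p2 i) P.μ ψ - cP * energyScalar 1 1 0 ψ) fun t => ?_)
    -- Coercivity does not require compatibility, so `ψ` is free at both ends; shifting `η` along
    -- with `φ(1)` keeps `η - φ(1)` fixed.
    have h1 := hA.coercive _ (η + t • EuclideanSpace.single i (ψ 1)) (hH t)
    rw [V_eq_energy, h1NormSq_eq_energy, energy_add_single h _ _ _ t i hψ,
      energy_add_single h _ _ _ t i hψ, add_sub_add_right_eq_sub] at h1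
    rw [V_eq_energy, h1NormSq_eq_energy] at hV
    simp only [Pi.one_apply] at h1
    linarith
  · intro h0 h1
    have hs : (EuclideanSpace.single i 0 : E n) = 0 := by rw [single_eq_smul, zero_smul]
    have h2 : cD * energyCross 1 1 0 i φ ψ = 0 := by
      -- The maximum bound requires compatibility, which survives because `ψ` vanishes at both ends;
      -- `φ(1)` is unchanged, so only the `H¹` energy varies.
      refine eq_zero_of_quadratic_nonneg (b := cD * energyScalar 1 1 0 ψ) fun t => ?_
      have h3 := hA.max_bound _ η (hH t) (by
        unfold Compat at hc ⊢
        simpa [h0, h1, hs] using hc) 1 (right_mem_Icc.2 zero_le_one)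
      rw [h1NormSq_eq_energy, energy_add_single h _ _ _ t i hψ] at h3
      simp only [h1, hs, smul_zero, add_zero, hN] at h3
      rw [h1NormSq_eq_energy] at h3
      simp only [Pi.one_apply] at h3
      linarith
    exact (mul_eq_zero.1 h2).resolve_left hA.cD_pos.ne'

/-- Testing the weighted stationarity with `exp(μz) θ` cancels the weight and leaves `p₁∫φθ +
p₂(μ∫φ'θ + ∫φ'θ') = 0`. Subtracting `p₂` times the unweighted relation `∫φθ + ∫φ'θ' = 0` removes
`θ'`, so a first-order equation remains. -/
theorem extremal_ode {cP cD σ χ : ℝ} (hA : P.Admissible cP cD σ χ) {φ : ℝ → E n}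
    {η : E n} (h : IsH1 φ) (hc : P.Compat φ η)
    (hV : P.V φ η = cP * (h1NormSq φ + ‖η - φ 1‖ ^ 2))
    (hN : ‖φ 1‖ ^ 2 = cD * (h1NormSq φ + ‖η - φ 1‖ ^ 2)) (i : Fin n) :
    ∀ᵐ z, z ∈ Ioo (0 : ℝ) 1 →
      (P.p1 i - P.p2 i) * φ z i + P.μ * P.p2 i * deriv φ z i = 0 := by
  have hφ : ContinuousOn (fun z => φ z i) (uIcc 0 1) := by
    rw [uIcc_of_le zero_le_one]
    exact (EuclideanSpace.proj i : E n →L[ℝ] ℝ).continuous.comp_continuousOn h.continuousOn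
  have hd := h.intervalIntegrable_apply i
  have hint : IntervalIntegrable
      (fun z => (P.p1 i - P.p2 i) * φ z i + P.μ * P.p2 i * deriv φ z i) volume 0 1 :=
    (hφ.intervalIntegrable.const_mul _).add (hd.const_mul _)
  refine IsOpen.ae_eq_zero_of_integral_contDiff_smul_eq_zero isOpen_Ioo ?_ ?_
  · rw [intervalIntegrable_iff_integrableOn_Ioo_of_le zero_le_one] at hint
    exact hint.locallyIntegrableOn
  · intro θ hθ _ hs
    have h0 : θ 0 = 0 := image_eq_zero_of_notMem_tsupport fun hm => lt_irrefl _ (hs hm).1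
    have h1 : θ 1 = 0 := image_eq_zero_of_notMem_tsupport fun hm => lt_irrefl _ (hs hm).2
    have hexp : ContDiff ℝ ∞ fun z : ℝ => Real.exp (P.μ * z) := by fun_prop
    have hψ : ContDiff ℝ ∞ fun z => Real.exp (P.μ * z) * θ z := hexp.mul hθ
    have hθ' : Continuous (deriv θ) := hθ.continuous_deriv (by simp)
    have hθc := hθ.continuous
    have hb := (first_variation hA h hc hV hN i hθ).2 h0 h1
    have hb2 := (first_variation hA h hc hV hN i hψ).2 (by simp [h0]) (by simp [h1])
    have ha := (first_variation hA h hc hV hN i hψ).1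
    rw [hb2, mul_zero] at ha
    have hdψ : deriv (fun z => Real.exp (P.μ * z) * θ z) =
        fun z => Real.exp (P.μ * z) * (P.μ * θ z + deriv θ z) := by
      ext z
      have e1 : HasDerivAt (fun z => Real.exp (P.μ * z)) (Real.exp (P.μ * z) * P.μ) z := by
        simpa using ((hasDerivAt_id z).const_mul P.μ).exp
      rw [(e1.fun_mul (hθ.differentiable (by simp) z).hasDerivAt).deriv]
      ring
    have e2 : ∀ z, Real.exp (P.μ * z) * Real.exp (-P.μ * z) = 1 := fun z => by
      rw [← Real.exp_add]; simp
    have a1 : ∫ z in (0 : ℝ)..1, φ z i * (Real.exp (P.μ * z) * θ z) * Real.exp (-P.μ * z) =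
        ∫ z in (0 : ℝ)..1, φ z i * θ z := intervalIntegral.integral_congr fun z _ => by
      linear_combination (φ z i * θ z) * e2 z
    have i1 : IntervalIntegrable (fun z => φ z i * θ z) volume 0 1 :=
      (hφ.mul hθc.continuousOn).intervalIntegrable
    have i2 : IntervalIntegrable (fun z => deriv φ z i * θ z) volume 0 1 :=
      hd.mul_continuousOn hθc.continuousOn
    have i3 : IntervalIntegrable (fun z => deriv φ z i * deriv θ z) volume 0 1 :=
      hd.mul_continuousOn hθ'.continuousOn
    have a2 : ∫ z in (0 : ℝ)..1, deriv φ z i * (Real.exp (P.μ * z) * (P.μ * θ z + deriv θ z)) *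
        Real.exp (-P.μ * z) = P.μ * (∫ z in (0 : ℝ)..1, deriv φ z i * θ z) +
          ∫ z in (0 : ℝ)..1, deriv φ z i * deriv θ z := by
      rw [← intervalIntegral.integral_const_mul, ← intervalIntegral.integral_add (i2.const_mul _) i3]
      refine intervalIntegral.integral_congr fun z _ => ?_
      linear_combination (deriv φ z i * (P.μ * θ z + deriv θ z)) * e2 z
    simp only [energyCross, hdψ, a1, a2] at ha
    simp only [energyCross, neg_zero, zero_mul, Real.exp_zero, mul_one, one_mul] at hb
    have hsupp : ∫ z, θ z • ((P.p1 i - P.p2 i) * φ z i + P.μ * P.p2 i * deriv φ z i) =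
        ∫ z in (0 : ℝ)..1, θ z • ((P.p1 i - P.p2 i) * φ z i + P.μ * P.p2 i * deriv φ z i) := by
      refine (intervalIntegral.integral_eq_integral_of_support_subset ?_).symm
      exact (Function.support_smul_subset_left _ _).trans
        ((subset_tsupport θ).trans (hs.trans Ioo_subset_Ioc_self))
    have hsplit : ∫ z in (0 : ℝ)..1,
        θ z • ((P.p1 i - P.p2 i) * φ z i + P.μ * P.p2 i * deriv φ z i) =
        (P.p1 i - P.p2 i) * (∫ z in (0 : ℝ)..1, φ z i * θ z) +
          P.μ * P.p2 i * ∫ z in (0 : ℝ)..1, deriv φ z i * θ z := by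
      rw [← intervalIntegral.integral_const_mul, ← intervalIntegral.integral_const_mul,
        ← intervalIntegral.integral_add (i1.const_mul _) (i2.const_mul _)]
      refine intervalIntegral.integral_congr fun z _ => ?_
      simp only [smul_eq_mul]
      ring
    rw [hsupp, hsplit]
    linear_combination ha - P.p2 i * hb

/-- The bounds on `V` and on the maximum cannot both be attained. -/
theorem norm_sq_lt (hP : P.GainCond) {cP cD σ χ : ℝ} (hA : P.Admissible cP cD σ χ) {φ : ℝ → E n}
    {η : E n} (h : IsH1 φ) (hc : P.Compat φ η) (h1 : φ 1 ≠ 0) :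
    cP * ‖φ 1‖ ^ 2 < cD * P.V φ η := by
  by_contra hle
  push Not at hle
  have hcP := hA.cP_pos
  have hcD := hA.cD_pos
  have g1 := hA.coercive φ η h
  have g2 := hA.max_bound φ η h hc 1 (right_mem_Icc.2 zero_le_one)
  have hV : P.V φ η = cP * (h1NormSq φ + ‖η - φ 1‖ ^ 2) := by
    refine le_antisymm ?_ g1
    have : cD * P.V φ η ≤ cD * (cP * (h1NormSq φ + ‖η - φ 1‖ ^ 2)) :=
      hle.trans ((mul_le_mul_of_nonneg_left g2 hcP.le).trans (le_of_eq (by ring)))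
    exact le_of_mul_le_mul_left this hcD
  have hN : ‖φ 1‖ ^ 2 = cD * (h1NormSq φ + ‖η - φ 1‖ ^ 2) := by
    refine le_antisymm g2 ?_
    have : cP * (cD * (h1NormSq φ + ‖η - φ 1‖ ^ 2)) ≤ cP * ‖φ 1‖ ^ 2 := by
      rw [hV] at hle
      linarith
    exact le_of_mul_le_mul_left this hcP
  obtain ⟨i, hi⟩ : ∃ i, φ 1 i ≠ 0 := by
    by_contra hcon
    push Not at hcon
    exact h1 (by ext i; simpa using hcon i)
  have hp2 := p2_pos hP i
  have hμ := hP.μ_pos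
  set k : ℝ := (P.p2 i - P.p1 i) / (P.μ * P.p2 i) with hk
  have hk1 : P.p1 i = P.p2 i - k * (P.μ * P.p2 i) := by
    rw [hk, div_mul_cancel₀ _ (by positivity)]; ring
  have hd : ∀ᵐ z, z ∈ Ioo (0 : ℝ) 1 → deriv φ z i = k * φ z i := by
    filter_upwards [extremal_ode hA h hc hV hN i] with z hz hz1
    have h3 := hz hz1
    rw [hk1] at h3
    have h4 : (P.μ * P.p2 i) * (deriv φ z i - k * φ z i) = 0 := by linarith
    exact sub_eq_zero.1 ((mul_eq_zero.1 h4).resolve_left (by positivity))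
  -- Integrating factor: the product is absolutely continuous with zero derivative a.e., so the
  -- component is `C exp(kz)`.
  obtain ⟨C, hC⟩ : ∃ C, ∀ z ∈ uIcc (0 : ℝ) 1, φ z i * Real.exp (-k * z) = C := by
    have hexp : ContDiff ℝ 1 fun z : ℝ => Real.exp (-k * z) := by fun_prop
    have hac := (h.absolutelyContinuous i).fun_mul
      (hexp.contDiffOn (s := uIcc (0 : ℝ) 1)).absolutelyContinuousOnInterval
    refine hac.const_of_ae_hasDerivAt_zero ?_
    have e0 : ∀ᵐ x : ℝ, x ≠ 0 := by simp [ae_iff, measure_singleton]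
    have e1 : ∀ᵐ x : ℝ, x ≠ 1 := by simp [ae_iff, measure_singleton]
    filter_upwards [hd, h.ae_hasDerivAt_apply i, e0, e1] with z z1 z2 z3 z4 hz
    rw [uIcc_of_le zero_le_one] at hz
    have hz' : z ∈ Ioo (0 : ℝ) 1 := ⟨lt_of_le_of_ne hz.1 z3.symm, lt_of_le_of_ne hz.2 z4⟩
    have e3 : HasDerivAt (fun z => Real.exp (-k * z)) (Real.exp (-k * z) * -k) z := by
      simpa using ((hasDerivAt_id z).const_mul (-k)).exp
    refine ((z2 hz').fun_mul e3).congr_deriv ?_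
    rw [z1 hz']
    ring
  have hC0 : C ≠ 0 := by
    rw [← hC 1 right_mem_uIcc]
    exact mul_ne_zero hi (Real.exp_pos _).ne'
  -- The factor `exp(-kz)` in the test function cancels the exponential in `φ`, so the integrals
  -- below are elementary.
  have hcross : ∀ (p q μ : ℝ) (θ θ' : ℝ → ℝ), (∀ z, HasDerivAt θ (θ' z) z) →
      energyCross p q μ i φ (fun z => Real.exp (-k * z) * θ z) =
      C * (p * (∫ z in (0 : ℝ)..1, θ z * Real.exp (-μ * z)) +
        q * ∫ z in (0 : ℝ)..1, (k * θ' z - k ^ 2 * θ z) * Real.exp (-μ * z)) := by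
    intro p q μ θ θ' hθ
    have hdψ : ∀ z, deriv (fun z => Real.exp (-k * z) * θ z) z =
        Real.exp (-k * z) * (θ' z - k * θ z) := by
      intro z
      have e3 : HasDerivAt (fun z => Real.exp (-k * z)) (Real.exp (-k * z) * -k) z := by
        simpa using ((hasDerivAt_id z).const_mul (-k)).exp
      rw [(e3.fun_mul (hθ z)).deriv]
      ring
    have a1 : ∫ z in (0 : ℝ)..1, φ z i * (Real.exp (-k * z) * θ z) * Real.exp (-μ * z) =
        C * ∫ z in (0 : ℝ)..1, θ z * Real.exp (-μ * z) := by
      rw [← intervalIntegral.integral_const_mul]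
      refine intervalIntegral.integral_congr fun z hz => ?_
      simp only [← hC z hz]
      ring
    have a2 : ∫ z in (0 : ℝ)..1, deriv φ z i * deriv (fun z => Real.exp (-k * z) * θ z) z *
        Real.exp (-μ * z) = C * ∫ z in (0 : ℝ)..1,
          (k * θ' z - k ^ 2 * θ z) * Real.exp (-μ * z) := by
      rw [← intervalIntegral.integral_const_mul]
      refine intervalIntegral.integral_congr_ae (ae_uIoc_of_ae_Ioo zero_le_one ?_)
      filter_upwards [hd] with z hz hz1
      rw [hz hz1, hdψ, ← hC z (by rw [uIcc_of_le zero_le_one]; exact Ioo_subset_Icc_self hz1)]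
      ring
    rw [energyCross, a1, a2]
    ring
  have hexp : ContDiff ℝ ∞ fun z : ℝ => Real.exp (-k * z) := by fun_prop
  -- The bump `z - z²` vanishes at both ends and turns the unweighted stationarity into `C (1 -
  -- k²)/6 = 0`.
  have hksq : k ^ 2 = 1 := by
    have hθ : ∀ z : ℝ, HasDerivAt (fun z : ℝ => z - z ^ 2) (1 - 2 * z) z := fun z => by
      simpa using (hasDerivAt_id z).fun_sub (hasDerivAt_pow 2 z)
    have h3 := (first_variation hA h hc hV hN i (ψ := fun z => Real.exp (-k * z) * (z - z ^ 2))
      (hexp.mul (by fun_prop))).2 (by simp) (by simp)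
    rw [hcross 1 1 0 _ _ hθ] at h3
    have h4 := (mul_eq_zero.1 h3).resolve_left hC0
    simp only [neg_zero, zero_mul, Real.exp_zero, mul_one, one_mul] at h4
    have c1 : IntervalIntegrable (fun z : ℝ => 1 - 2 * z) volume 0 1 :=
      Continuous.intervalIntegrable (by fun_prop) _ _
    have c2 : IntervalIntegrable (fun z : ℝ => z - z ^ 2) volume 0 1 :=
      Continuous.intervalIntegrable (by fun_prop) _ _
    have j1 : ∫ z in (0 : ℝ)..1, (z - z ^ 2) = 1 / 6 := by
      rw [intervalIntegral.integral_sub (by simp) (by simp)]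
      simp
      norm_num
    have j2 : ∫ z in (0 : ℝ)..1, (1 - 2 * z) = 0 := by
      rw [intervalIntegral.integral_eq_sub_of_hasDerivAt (fun z _ => hθ z) c1]
      norm_num
    rw [intervalIntegral.integral_sub (c1.const_mul _) (c2.const_mul _),
      intervalIntegral.integral_const_mul, intervalIntegral.integral_const_mul, j1, j2] at h4
    linarith
  -- A variation not vanishing at the ends: as `k² = 1`, the unweighted cross term is zero and the
  -- weighted one is `C (p₁ - p₂)∫exp(-μz)`.
  have h3 := (first_variation hA h hc hV hN i (ψ := fun z => Real.exp (-k * z) * 1)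
    (hexp.mul contDiff_const)).1
  rw [hcross _ _ _ (fun _ => 1) (fun _ => 0) (fun z => hasDerivAt_const z 1),
    hcross _ _ _ (fun _ => 1) (fun _ => 0) (fun z => hasDerivAt_const z 1)] at h3
  have hI : 0 < ∫ z in (0 : ℝ)..1, Real.exp (-P.μ * z) :=
    intervalIntegral.intervalIntegral_pos_of_pos
      (Continuous.intervalIntegrable (by fun_prop) _ _) (fun _ => Real.exp_pos _) zero_lt_one
  simp only [hksq, mul_zero, zero_sub, mul_one, one_mul, neg_zero, zero_mul, Real.exp_zero,
    neg_mul, intervalIntegral.integral_neg, intervalIntegral.integral_const, sub_zero,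
    smul_eq_mul] at h3 hI
  have h4 : C * ((P.p1 i - P.p2 i) * ∫ z in (0 : ℝ)..1, Real.exp (-(P.μ * z))) = 0 := by
    linarith
  have h5 : P.p1 i - P.p2 i = 0 :=
    (mul_eq_zero.1 ((mul_eq_zero.1 h4).resolve_left hC0)).resolve_right hI.ne'
  have h6 : k = 0 := by rw [hk, show P.p2 i - P.p1 i = 0 by linarith, zero_div]
  rw [h6] at hksq
  norm_num at hksq

end LoopData

/-! ### The quantized loop: invariance of the level set and the ultimate bound. -/

variable {n : ℕ}

theorem abs_apply_le_supNorm (x : E n) (i : Fin n) : |x i| ≤ supNorm x :=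
  norm_le_pi_norm (fun i => x i : Fin n → ℝ) i

theorem supNorm_le_norm (x : E n) : supNorm x ≤ ‖x‖ :=
  (pi_norm_le_iff_of_nonneg (norm_nonneg x)).2 fun i => PiLp.norm_apply_le x i

theorem norm_sq_le_of_supNorm_le {x : E n} {r : ℝ} (h : supNorm x ≤ r) : ‖x‖ ^ 2 ≤ n * r ^ 2 := by
  rw [EuclideanSpace.real_norm_sq_eq]
  have : ∀ i ∈ Finset.univ, x i ^ 2 ≤ r ^ 2 := fun i _ =>
    sq_le_sq' (abs_le.1 ((abs_apply_le_supNorm x i).trans h)).1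
      (abs_le.1 ((abs_apply_le_supNorm x i).trans h)).2
  simpa using Finset.sum_le_card_nsmul _ _ _ this

/-- A sublevel set is forward invariant if the function cannot grow, locally and to the right, as
long as it stays above the level. -/
theorem sublevel_invariant {W : ℝ → ℝ} {c t₀ : ℝ} (hW : ContinuousOn W (Ici t₀)) (h0 : W t₀ ≤ c)
    (hstep : ∀ s, t₀ ≤ s → W s ≤ c → ∀ᶠ t in 𝓝[>] s, (∀ r ∈ Icc s t, c ≤ W r) → W t ≤ W s) {t : ℝ}
    (ht : t₀ ≤ t) : W t ≤ c := by
  have hclosed : IsClosed ({t | W t ≤ c} ∩ Icc t₀ t) := by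
    rw [inter_comm]
    exact (hW.mono Icc_subset_Ici_self).preimage_isClosed_of_isClosed isClosed_Icc isClosed_Iic
  refine hclosed.Icc_subset_of_forall_exists_gt h0 (fun s hs u hu => ?_) ⟨ht, le_rfl⟩
  by_contra hne
  rw [not_nonempty_iff_eq_empty] at hne
  -- If the sublevel set had no point just after `s`, then `W` would exceed `c` there and, by
  -- continuity, `W s ≥ c`; the local hypothesis then gives `W ≤ W s ≤ c` right after `s`, a
  -- contradiction.
  have hgt : ∀ r ∈ Ioc s u, c < W r := fun r hr => by
    by_contra hle
    have : r ∈ ({t | W t ≤ c} ∩ Ioc s u) := ⟨not_lt.1 hle, hr⟩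
    rw [hne] at this
    exact this
  have hsu : Ioc s u ∈ 𝓝[>] s := Ioc_mem_nhdsGT hu
  have hs0 : t₀ ≤ s := hs.2.1
  have hge : c ≤ W s := by
    have h1 : Tendsto W (𝓝[>] s) (𝓝 (W s)) :=
      (hW s hs0).mono_left (nhdsWithin_mono _ fun x hx => hs0.trans (le_of_lt hx))
    refine ge_of_tendsto h1 ?_
    filter_upwards [hsu] with r hr using (hgt r hr).le
  obtain ⟨r, hr, hru⟩ := ((hstep s hs0 hs.1).and hsu).exists
  refine absurd (hr fun r' hr' => ?_) (not_le.2 (lt_of_le_of_lt hs.1 (hgt r hru)))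
  rcases hr'.1.eq_or_lt with rfl | h2
  · exact hge
  · exact (hgt r' ⟨h2, hr'.2.trans hru.2⟩).le

namespace LoopData

variable {m : ℕ} {P : LoopData n m} {Xi : ℝ → E n} {ηi : E n} {y : ℝ → E n}
  {X : ℝ → ℝ → E n} {η : ℝ → E n} {cP cD σ χ : ℝ}

/-- Needed because the initial condition fixes `X 0` only on `[0,1]`. -/
theorem V_congr (P : LoopData n m) {φ φ' : ℝ → E n} (η : E n)
    (h : ∀ z ∈ Icc (0 : ℝ) 1, φ z = φ' z) : P.V φ η = P.V φ' η := by
  unfold V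
  rw [h 1 (right_mem_Icc.2 zero_le_one)]
  congr 2
  · refine intervalIntegral.integral_congr fun z hz => ?_
    rw [uIcc_of_le zero_le_one] at hz
    simp only [h z hz]
  · refine intervalIntegral.integral_congr_ae (ae_uIoc_of_ae_Ioo zero_le_one ?_)
    refine ae_of_all _ fun z hz => ?_
    have : φ =ᶠ[𝓝 z] φ' := by
      filter_upwards [Icc_mem_nhds hz.1 hz.2] with x hx using h x hx
    rw [this.deriv_eq]

theorem Admissible.norm_sq_le (hA : P.Admissible cP cD σ χ) {φ : ℝ → E n} {η : E n} (h : IsH1 φ)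
    (hc : P.Compat φ η) {z : ℝ} (hz : z ∈ Icc (0 : ℝ) 1) : ‖φ z‖ ^ 2 ≤ cD / cP * P.V φ η := by
  have h1 := hA.coercive φ η h
  have h2 := hA.max_bound φ η h hc z hz
  have hcP := hA.cP_pos
  have hcD := hA.cD_pos
  rw [div_mul_eq_mul_div, le_div_iff₀ hcP]
  calc ‖φ z‖ ^ 2 * cP ≤ cD * (h1NormSq φ + ‖η - φ 1‖ ^ 2) * cP := by gcongr
    _ = cD * (cP * (h1NormSq φ + ‖η - φ 1‖ ^ 2)) := by ring
    _ ≤ cD * P.V φ η := by gcongr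

namespace IsSolution

theorem continuousOn_V (hS : P.IsSolution Xi ηi y X η) (hP : P.GainCond) :
    ContinuousOn (fun t => P.V (X t) (η t)) (Ici 0) := by
  intro t ht
  have ht' : (0 : ℝ) ≤ t := ht
  have h := (hS.absolutelyContinuous_V hP (show (0 : ℝ) ≤ t + 1 by linarith)).continuousOn
  rw [uIcc_of_le (by linarith)] at h
  refine (h t ⟨ht', by linarith⟩).mono_of_mem_nhdsWithin ?_
  rw [← Ici_inter_Iic]
  exact inter_mem self_mem_nhdsWithin (mem_nhdsWithin_of_mem_nhds (Iic_mem_nhds (by linarith)))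

theorem continuousOn_apply_one (hS : P.IsSolution Xi ηi y X η) :
    ContinuousOn (fun t => X t 1) (Ici 0) :=
  hS.continuousOn_uncurry.comp (f := fun t : ℝ => (t, (1 : ℝ))) (by fun_prop) fun t ht =>
    ⟨ht, by simp⟩

/-- Lets any measurement be read as `X(1,·)` plus a disturbance to which the dissipation inequality
applies; for the quantized loop this is the quantization error. -/
theorem memLp_sub_apply_one (hS : P.IsSolution Xi ηi y X η) {T : ℝ} (hT : 0 ≤ T) :
    MemLp (fun t => y t - X t 1) ⊤ (volume.restrict (Icc (0 : ℝ) T)) := by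
  have hc := hS.continuousOn_apply_one.mono (show Icc 0 T ⊆ Ici 0 from fun _ hr => hr.1)
  obtain ⟨C, hC⟩ := isCompact_Icc.exists_bound_of_continuousOn hc
  exact (hS.meas T hT).sub (MemLp.of_bound (hc.aestronglyMeasurable measurableSet_Icc) C
    ((ae_restrict_iff' measurableSet_Icc).2 (ae_of_all _ hC)))

/-- Decrease of `V` while it stays above a level and the measurement error is small. -/
theorem V_le_sub (hS : P.IsSolution Xi ηi y X η) (hP : P.GainCond) (hA : P.Admissible cP cD σ χ)
    {c δ s t : ℝ} (hs : 0 ≤ s) (hst : s ≤ t) (hV : ∀ r ∈ Icc s t, c ≤ P.V (X r) (η r))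
    (hd : ∀ r ∈ Icc s t, ‖y r - X r 1‖ ^ 2 ≤ δ) :
    P.V (X t) (η t) ≤ P.V (X s) (η s) - (σ * c - χ * δ) * (t - s) := by
  have hS' : P.IsSolution Xi ηi (fun t => X t 1 + (y t - X t 1)) X η := by
    simpa only [add_sub_cancel] using hS
  have ht : 0 ≤ t := hs.trans hst
  have hsub : uIcc s t ⊆ uIcc 0 t := by
    rw [uIcc_of_le hst, uIcc_of_le ht]; exact Icc_subset_Icc_left hs
  have h1 := hA.dissip Xi ηi (fun t => y t - X t 1) X η (fun T hT => hS.memLp_sub_apply_one hT)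
    hS' s t hs hst
  have hdi : IntervalIntegrable (fun r => χ * ‖y r - X r 1‖ ^ 2) volume s t := by
    have h1 : IntervalIntegrable (fun r => ‖y r - X r 1‖ ^ 2) volume 0 t := by
      rw [intervalIntegrable_iff_integrableOn_Icc_of_le ht]
      exact ((hS.memLp_sub_apply_one ht).mono_exponent (p := 2) le_top).integrable_norm_pow
        (by norm_num)
    exact (h1.mono_set hsub).const_mul _
  have hVi : IntervalIntegrable (fun r => -σ * P.V (X r) (η r)) volume s t := by
    refine IntervalIntegrable.const_mul (ContinuousOn.intervalIntegrable ?_) _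
    rw [uIcc_of_le hst]
    exact (hS.continuousOn_V hP).mono fun r hr => hs.trans hr.1
  have h2 : ∫ r in s..t, (-σ * P.V (X r) (η r) + χ * ‖y r - X r 1‖ ^ 2) ≤
      ∫ r in s..t, -(σ * c - χ * δ) := by
    refine intervalIntegral.integral_mono_on hst (hVi.add hdi) (by simp) fun r hr => ?_
    have h3 := mul_le_mul_of_nonneg_left (hV r hr) hA.σ_pos.le
    have h4 := mul_le_mul_of_nonneg_left (hd r hr) hA.χ_pos.le
    linarith
  rw [intervalIntegral.integral_const, smul_eq_mul] at h2
  linarith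

end IsSolution

/-- Strictness, from `norm_sq_lt`, leaves room inside the quantizer range even on the edge of the
level set. -/
theorem norm_lt_of_V_le (hP : P.GainCond) (hA : P.Admissible cP cD σ χ) {M : ℝ} (hM : 0 < M)
    {φ : ℝ → E n} {η : E n} (h : IsH1 φ) (hc : P.Compat φ η) (hV : P.V φ η ≤ cP / cD * M ^ 2) :
    ‖φ 1‖ < M := by
  rcases eq_or_ne (φ 1) 0 with h0 | h0
  · rwa [h0, norm_zero]
  have hcP := hA.cP_pos
  have hcD := hA.cD_pos
  have h1 := norm_sq_lt hP hA h hc h0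
  have h2 : cD * P.V φ η ≤ cP * M ^ 2 := by
    calc cD * P.V φ η ≤ cD * (cP / cD * M ^ 2) := by gcongr
      _ = cP * M ^ 2 := by field_simp
  have h3 := lt_of_mul_lt_mul_left (h1.trans_le h2) hcP.le
  exact lt_of_pow_lt_pow_left₀ 2 hM.le h3

section Quantized

variable {q : E n → E n} {M Δ : ℝ}

theorem quantization_error_le (hq : IsQuantizer q M Δ) {x : E n} (hx : ‖x‖ ≤ M) :
    ‖q x - x‖ ^ 2 ≤ n * Δ ^ 2 :=
  norm_sq_le_of_supNorm_le (hq.error_le x ((supNorm_le_norm x).trans hx))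

theorem level_invariant (hP : P.GainCond) (hA : P.Admissible cP cD σ χ) (hq : IsQuantizer q M Δ)
    (hgap : M ^ 2 / Δ ^ 2 > n * cD * χ / (cP * σ)) (hV : P.V Xi ηi ≤ cP / cD * M ^ 2)
    (hS : P.IsSolution Xi ηi (fun t => q (X t 1)) X η) {t : ℝ} (ht : 0 ≤ t) :
    P.V (X t) (η t) ≤ cP / cD * M ^ 2 := by
  have hcP := hA.cP_pos
  have hcD := hA.cD_pos
  have hσ := hA.σ_pos
  have hΔ := hq.Δ_pos
  -- The range condition says that decay at the level dominates the worst error, `|d|² ≤ n Δ²`, the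
  -- factor `n` coming from the maximum norm.
  have hlevel : 0 ≤ σ * (cP / cD * M ^ 2) - χ * (n * Δ ^ 2) := by
    rw [gt_iff_lt, div_lt_div_iff₀ (by positivity) (by positivity)] at hgap
    have h1 : cD * (χ * (n * Δ ^ 2)) ≤ cD * (σ * (cP / cD * M ^ 2)) := by
      have : cD * (σ * (cP / cD * M ^ 2)) = M ^ 2 * (cP * σ) := by field_simp
      rw [this]
      linarith
    linarith [le_of_mul_le_mul_left h1 hcD]
  refine sublevel_invariant (W := fun t => P.V (X t) (η t)) (hS.continuousOn_V hP) ?_ ?_ ht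
  · rwa [P.V_congr _ hS.init_X, hS.init_eta]
  · intro s hs hVs
    have h1 := norm_lt_of_V_le hP hA hq.M_pos (hS.h1 s hs) (hS.bdry s hs) hVs
    -- By continuity the measurement stays in range for a short time after `s`, so the error bound
    -- is available exactly where `sublevel_invariant` asks for it.
    have h2 : ∀ᶠ r in 𝓝[≥] s, ‖X r 1‖ < M :=
      ((hS.continuousOn_apply_one.norm s hs).mono (Ici_subset_Ici.2 hs)).eventually
        (gt_mem_nhds h1)
    obtain ⟨u, hu, hu2⟩ := (mem_nhdsGE_iff_exists_Icc_subset).1 h2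
    filter_upwards [Ioc_mem_nhdsGT hu] with t ht hc
    have h3 := hS.V_le_sub hP hA (δ := n * Δ ^ 2) hs ht.1.le hc fun r hr =>
      quantization_error_le hq (le_of_lt (hu2 ⟨hr.1, hr.2.trans ht.2⟩))
    have h4 := mul_nonneg hlevel (sub_nonneg.2 ht.1.le)
    linarith

theorem eventually_V_le (hP : P.GainCond) (hA : P.Admissible cP cD σ χ)
    (hS : P.IsSolution Xi ηi y X η) {c δ : ℝ} (hc : χ * δ < σ * c)
    (hd : ∀ t, 0 ≤ t → ‖y t - X t 1‖ ^ 2 ≤ δ) :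
    ∃ T, 0 ≤ T ∧ ∀ t, T ≤ t → P.V (X t) (η t) ≤ c := by
  have hpos : 0 < σ * c - χ * δ := sub_pos.2 hc
  obtain ⟨T, hT, hTV⟩ : ∃ T, 0 ≤ T ∧ P.V (X T) (η T) ≤ c := by
    by_contra hcon
    push Not at hcon
    have hV0 := V_nonneg hP (X 0) (η 0)
    -- If `V` stayed above `c`, it would drop at rate at least `σc - χδ` and reach `-1` at this
    -- time.
    set t := (P.V (X 0) (η 0) + 1) / (σ * c - χ * δ) with ht
    have ht0 : 0 ≤ t := by positivity
    have h1 := hS.V_le_sub hP hA (c := c) (δ := δ) le_rfl ht0 (fun r hr => (hcon r hr.1).le)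
      fun r hr => hd r hr.1
    rw [sub_zero, ht, mul_div_cancel₀ _ hpos.ne'] at h1
    linarith [V_nonneg hP (X t) (η t)]
  refine ⟨T, hT, fun t ht => ?_⟩
  refine sublevel_invariant (W := fun t => P.V (X t) (η t))
    ((hS.continuousOn_V hP).mono (Ici_subset_Ici.2 hT)) hTV (fun s hs _ => ?_) ht
  filter_upwards [self_mem_nhdsWithin] with u hu hr
  have hsu : s ≤ u := le_of_lt hu
  have h1 := hS.V_le_sub hP hA (hT.trans hs) hsu hr fun r hr => hd r (hT.trans (hs.trans hr.1))
  have h2 := mul_nonneg hpos.le (sub_nonneg.2 hsu)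
  linarith

end Quantized

end LoopData

end HypQuant

/-! ### The main theorem. -/

theorem theorem3 {n m : ℕ} (hn : 0 < n) (P : HypQuant.LoopData n m) (hP : P.GainCond) :
    P.Admissible P.cP P.cD P.sigma P.chi ∧
    ∀ cP cD σ χ : ℝ, P.Admissible cP cD σ χ →
      ∀ (M Δ : ℝ) (q : HypQuant.E n → HypQuant.E n), HypQuant.IsQuantizer q M Δ →
        M ^ 2 / Δ ^ 2 > n * cD * χ / (cP * σ) →
        ∀ (Xi : ℝ → HypQuant.E n) (ηi : HypQuant.E n)
          (X : ℝ → ℝ → HypQuant.E n) (η : ℝ → HypQuant.E n),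
          P.V Xi ηi ≤ cP / cD * M ^ 2 →
          P.IsSolution Xi ηi (fun t => q (X t 1)) X η →
          (∀ t : ℝ, 0 ≤ t → HypQuant.supNorm (X t 1) ≤ M) ∧
          (∀ ε : ℝ, 0 < ε → ∃ T : ℝ, 0 ≤ T ∧ ∀ t : ℝ, T ≤ t → ∀ z ∈ Set.Icc (0 : ℝ) 1,
            ‖X t z‖ ^ 2 ≤ n * χ * cD / (σ * cP) * Δ ^ 2 * (1 + ε)) := by
  refine ⟨HypQuant.LoopData.admissible hn hP, ?_⟩
  intro cP cD σ χ hA M Δ q hq hgap Xi ηi X η hV hS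
  have hcP := hA.cP_pos
  have hcD := hA.cD_pos
  have hσ := hA.σ_pos
  have hχ := hA.χ_pos
  have hΔ := hq.Δ_pos
  have hn' : (0 : ℝ) < n := by exact_mod_cast hn
  have hbound : ∀ t : ℝ, 0 ≤ t → ‖X t 1‖ ≤ M := fun t ht =>
    (HypQuant.LoopData.norm_lt_of_V_le hP hA hq.M_pos (hS.h1 t ht) (hS.bdry t ht)
      (HypQuant.LoopData.level_invariant hP hA hq hgap hV hS ht)).le
  refine ⟨fun t ht => (HypQuant.supNorm_le_norm _).trans (hbound t ht), fun ε hε => ?_⟩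
  -- The equilibrium level of the dissipation inequality with `|d|² = n Δ²` is `χ n Δ²/σ`; the
  -- factor `1 + ε` makes the decrease strict, so the level is reached in finite time.
  obtain ⟨T, hT, hTV⟩ := HypQuant.LoopData.eventually_V_le hP hA hS
    (c := χ * (n * Δ ^ 2) / σ * (1 + ε)) (δ := n * Δ ^ 2) (by
      have h1 : σ * (χ * (n * Δ ^ 2) / σ * (1 + ε)) = χ * (n * Δ ^ 2) * (1 + ε) := by field_simp
      have h2 : 0 < χ * (n * Δ ^ 2) * ε := by positivity
      rw [h1]
      linarith)
    fun t ht => HypQuant.LoopData.quantization_error_le hq (hbound t ht)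
  refine ⟨T, hT, fun t ht z hz => ?_⟩
  have ht0 := hT.trans ht
  calc ‖X t z‖ ^ 2 ≤ cD / cP * P.V (X t) (η t) := hA.norm_sq_le (hS.h1 t ht0) (hS.bdry t ht0) hz
    _ ≤ cD / cP * (χ * (n * Δ ^ 2) / σ * (1 + ε)) := by gcongr; exact hTV t ht
    _ = n * χ * cD / (σ * cP) * Δ ^ 2 * (1 + ε) := by field_simp
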